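/- For $\beta\in\mathbb R^d$, a positive definite matrix $\Sigma\in\mathbb R^{d\times d}$ and $\sigma>0$, let $\mathcal G(\beta,\Sigma,\sigma)$ be the distribution on $\mathbb R^{d+1}$ of $(X,y)$, where $X\sim N(0,\Sigma)$ and $y=\langle X,\beta\rangle+\eta$ with $\eta\sim N(0,\sigma^2)$ independent of $X$. A statistical query is a measurable function $f:\mathbb R^{d+1}\to[-1,1]$ asked at a tolerance $\tau>0$; a STAT oracle for a distribution $\mathcal D$ answers it with some value $v$ such that $|v-\mathbb E_{\mathcal D}f|\le\tau$. An SQ algorithm is a (deterministic, adaptive, computationally unrestricted) procedure which asks finitely many statistical queries, each depending on the answers to the previous ones, and then outputs a vector $\hat\beta\in\mathbb R^d$; it accesses the unknown distribution only through the oracle. There is an absolute constant $C>0$ such that the following holds for all positive integers $k,d$ with $k\le\sqrt d$, all $\epsilon\in(0,1/2)$ and all $c\in(0,1)$. There exist a set $\mathcal B\subset\mathbb R^d$ of $k$-sparse vectors, a number $\sigma$ with $0.99\le\sigma\le1$ and, for each $\beta^*\in\mathcal B$, a matrix $\Sigma_{\beta^*}$ with $\tfrac12\mathrm{Id}\preceq\Sigma_{\beta^*}\preceq\mathrm{Id}$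 and a probability distribution $\mathcal Q_{\beta^*}$ on $\mathbb R^{d+1}$, such that, writing $$\mathcal D_{\beta^*}=(1-\epsilon)\,\mathcal G(\beta^*,\Sigma_{\beta^*},\sigma)+\epsilon\,\mathcal Q_{\beta^*},$$ every SQ algorithm that, for each $\beta^*\in\mathcal B$ and each STAT oracle for $\mathcal D_{\beta^*}$, outputs $\hat\beta$ with $\|\beta^*-\hat\beta\|\le10^{-5}\sqrt\epsilon$ must, in its run with some STAT oracle for $\mathcal D_{\beta^*}$ for some $\beta^*\in\mathcal B$, either - make at least $d^{ck^c/8}\cdot k^{-4+4c}$ queries, or - make at least one query with tolerance smaller than $k^{-2+2c}\,e^{C/\epsilon}$. -/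

import Mathlib

open MeasureTheory ProbabilityTheory

/-- A statistical query on the sample space `Ω`: a (measurable) function `Ω → [-1, 1]` together with
the tolerance `τ > 0` at which it is asked. -/
structure StatQuery (Ω : Type*) [MeasurableSpace Ω] where
  /-- the query function -/
  f : Ω → ℝ
  measurable_f : Measurable f
  abs_f_le_one : ∀ x, |f x| ≤ 1
  /-- the tolerance -/
  tol : ℝ
  tol_pos : 0 < tol

/-- `O` is a STAT oracle for the distribution `μ`: its answer to each query `f` asked at
tolerance `τ` is within `τ` of the expectation of `f` under `μ`. -/
def IsSTATOracle {Ω : Type*} [MeasurableSpace Ω] (μ : Measure Ω) (O : StatQuery Ω → ℝ) : Prop :=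
  ∀ q : StatQuery Ω, |O q - ∫ x, q.f x ∂μ| ≤ q.tol

/-- An adaptive statistical query algorithm over the sample space `Ω` with outputs in `α`, as a
decision tree: it either stops with an output, or asks a query and continues in a way that depends
on the answer. Its only access to the unknown distribution is through the answers, and there is no
restriction on its computational power. -/
inductive SQAlgorithm (Ω : Type*) [MeasurableSpace Ω] (α : Type*) where
  | output (a : α) : SQAlgorithm Ω α
  | query (q : StatQuery Ω) (next : ℝ → SQAlgorithm Ω α) : SQAlgorithm Ω α

namespace SQAlgorithm

/-- The output of the algorithm when its queries are answered by `O`. -/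
def result {Ω : Type*} [MeasurableSpace Ω] {α : Type*} (O : StatQuery Ω → ℝ) :
    SQAlgorithm Ω α → α
  | output a => a
  | query q next => (next (O q)).result O

/-- The list of the queries that the algorithm makes when they are answered by `O`. -/
def queries {Ω : Type*} [MeasurableSpace Ω] {α : Type*} (O : StatQuery Ω → ℝ) :
    SQAlgorithm Ω α → List (StatQuery Ω)
  | output _ => []
  | query q next => q :: (next (O q)).queries O

end SQAlgorithm

/-- A vector with at most `k` nonzero entries. -/
def IsKSparse {d : ℕ} (k : ℕ) (β : EuclideanSpace ℝ (Fin d)) : Prop :=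
  {i | β i ≠ 0}.ncard ≤ k

/-- The sample space `ℝ^{d+1}`, whose points are written as pairs `(X, y)` with `X ∈ ℝ^d`, `y ∈ ℝ`. -/
abbrev RegressionSample (d : ℕ) : Type := EuclideanSpace ℝ (Fin d) × ℝ

/-- The law of `(X, y)` with `X ∼ N(0, S)` and `y = ⟨X, β⟩ + η`, where `η ∼ N(0, σ²)` is
independent of `X`. -/
noncomputable def gaussianRegression {d : ℕ} (β : EuclideanSpace ℝ (Fin d))
    (S : Matrix (Fin d) (Fin d) ℝ) (σ : ℝ) : Measure (RegressionSample d) :=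
  ((multivariateGaussian 0 S).prod (gaussianReal 0 (σ ^ 2).toNNReal)).map
    (fun p => (p.1, inner ℝ p.1 β + p.2))

/-- The mixture `(1 - ε) P + ε Q`. -/
noncomputable def contaminate {Ω : Type*} [MeasurableSpace Ω] (ε : ℝ) (P Q : Measure Ω) :
    Measure Ω :=
  ENNReal.ofReal (1 - ε) • P + ENNReal.ofReal ε • Q

/-! The construction hides a direction. For a sparse unit vector `v`, take `β = b • v` and a
covariance shrunk along `v`, tuned so that `y ∼ N(0, 1)` and, given `y`, `X` is standard across `v`
and `N(μ y, 1/2)` along `v`, where `μ = √ε / 10` (`gaussianRegression_eq_withDensity`). Outliers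
depending on `y` turn the conditional law along `v` into a mixture of Gaussians `N(a_j, 1/2)` of
mass `M(y) = 1 - ε/2 + ε y²/2` whose moments up to order three are those of `M(y) N(0, 1)`
(`nonempty_matchingMixture`). The reference distribution has density `M(y)` against the standard
Gaussian and does not depend on `v`.

Matching three moments makes correlations of fourth order. `N(a, 1/2)` is an average of the tilts
`exp(z t - z²/2)` over `z = a + i g / √2`, the imaginary noise removing half of the variance, and
the tilts by `z`, `z'` along `u`, `v` have correlation `exp(⟨u, v⟩ z z')`. In the expansion in `⟨u,
v⟩`, the orders one to three carry mixture moments of `z`, which vanish. Hence two deviations from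
the reference correlate by at most `64 exp(20/ε) ⟨u, v⟩⁴`
(`MatchingMixture.abs_integral_deviation_mul_le`).

A Reed-Solomon code yields `p ^ t` sparse directions with inner products at most `3 k^(c-1)`
(`exists_sparse_packing`). By a second moment argument, a query of tolerance at least `k^(-2+2c)
exp(20/ε)` tells at most `k^(4-4c) / 2` of them from the reference (`sq_card_mul_le_of_correlated`,
`card_le_of_sq_le`). An oracle that gives the reference answer whenever admissible therefore loses
few candidates per query; while two candidates survive they receive the same output, which cannot be
close to both of their separated parameters (`exists_oracle_of_learns`). -/

/-! ### Gaussians of variance 1/2 as averages of complex exponential tilts. -/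

/-- The density of `N(a, 1/2)` with respect to `N(0, 1)`. -/
noncomputable def gaussianTilt (a t : ℝ) : ℝ := √2 * Real.exp (-(t - a) ^ 2 + t ^ 2 / 2)

lemma gaussianTilt_pos (a t : ℝ) : 0 < gaussianTilt a t := by
  unfold gaussianTilt; positivity

lemma continuous_gaussianTilt : Continuous (fun p : ℝ × ℝ => gaussianTilt p.1 p.2) := by
  unfold gaussianTilt; fun_prop

lemma measurable_gaussianTilt {α : Type*} [MeasurableSpace α] {f g : α → ℝ}
    (hf : Measurable f) (hg : Measurable g) : Measurable fun x => gaussianTilt (f x) (g x) :=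
  continuous_gaussianTilt.measurable.comp (hf.prodMk hg)

/-- A crude domination that suffices for integrability, because Gaussian exponential moments are
finite. -/
lemma gaussianTilt_le (a t : ℝ) : gaussianTilt a t ≤ √2 * Real.exp (2 * a * t) := by
  unfold gaussianTilt
  gcongr
  nlinarith [sq_nonneg a, sq_nonneg t]

/-- The complex mixing variable representing `N(a, 1/2)`. -/
noncomputable def mixPoint (a g : ℝ) : ℂ := a + Complex.I * (g / √2 : ℝ)

lemma mixPoint_re (a g : ℝ) : (mixPoint a g).re = a := by simp [mixPoint]

lemma mixPoint_im (a g : ℝ) : (mixPoint a g).im = g / √2 := by simp [mixPoint]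

lemma normSq_mixPoint (a g : ℝ) : ‖mixPoint a g‖ ^ 2 = a ^ 2 + g ^ 2 / 2 := by
  rw [Complex.sq_norm, Complex.normSq_apply, mixPoint_re, mixPoint_im]
  have : (√2 : ℝ) ^ 2 = 2 := Real.sq_sqrt (by norm_num)
  field_simp
  rw [this]; ring

lemma mixPoint_sq (a g : ℝ) :
    mixPoint a g ^ 2 = ((a ^ 2 - g ^ 2 / 2 : ℝ) : ℂ) + Complex.I * ((√2 * a * g : ℝ) : ℂ) := by
  have h2 : (√2 : ℝ) * √2 = 2 := Real.mul_self_sqrt (by norm_num)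
  apply Complex.ext
  · simp only [sq, Complex.mul_re, mixPoint_re, mixPoint_im, Complex.add_re, Complex.ofReal_re,
      Complex.I_re, Complex.I_im, Complex.ofReal_im, zero_mul, mul_zero, sub_zero, add_zero]
    rw [div_mul_div_comm, h2]
  · simp only [sq, Complex.mul_im, mixPoint_re, mixPoint_im, Complex.add_im, Complex.ofReal_re,
      Complex.I_re, Complex.I_im, Complex.ofReal_im, zero_mul, zero_add, one_mul]
    field_simp
    rw [Real.sq_sqrt (by norm_num)]; ring

/-- The Fourier-Laplace transform of the standard Gaussian after a quadratic tilt. -/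
lemma integral_cexp_quarter_sq (c : ℂ) :
    ∫ g : ℝ, Complex.exp (g ^ 2 / 4 + c * g) ∂(gaussianReal 0 1) = √2 * Complex.exp (c ^ 2) := by
  rw [integral_gaussianReal_eq_integral_smul (by norm_num)]
  have h (x : ℝ) : gaussianPDFReal 0 1 x • Complex.exp (x ^ 2 / 4 + c * x)
      = ((√(2 * Real.pi))⁻¹ : ℝ) * Complex.exp ((-1 / 4 : ℂ) * x ^ 2 + c * x + 0) := by
    rw [gaussianPDFReal, Complex.real_smul]
    push_cast
    rw [mul_assoc, ← Complex.exp_add]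
    simp only [mul_one]
    congr 2; ring
  simp_rw [h]
  rw [integral_const_mul, integral_cexp_quadratic (by norm_num), ← mul_assoc]
  congr 1
  · have h1 : (Real.pi / -(-1 / 4 : ℂ)) = ((4 * Real.pi : ℝ) : ℂ) := by push_cast; ring
    rw [h1, show (1 / 2 : ℂ) = ((1 / 2 : ℝ) : ℂ) by push_cast; ring,
      ← Complex.ofReal_cpow (by positivity), ← Complex.ofReal_mul, ← Real.sqrt_eq_rpow]
    congr 1
    rw [inv_mul_eq_div, ← Real.sqrt_div (by positivity)]
    congr 1
    field_simp; norm_num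
  · congr 1; ring

lemma integrable_exp_quarter_sq (a : ℝ) :
    Integrable (fun g : ℝ => Real.exp (g ^ 2 / 4 + a * g)) (gaussianReal 0 1) := by
  have h := integral_cexp_quarter_sq a
  have hn : (√2 * Complex.exp ((a : ℂ) ^ 2) : ℂ) ≠ 0 := by
    simp
  rw [← h] at hn
  -- The Bochner integral of a non-integrable function is zero, so a nonzero value proves
  -- integrability.
  have hi := MeasureTheory.Integrable.of_integral_ne_zero hn
  convert hi.norm using 2 with g
  rw [Complex.norm_exp]
  norm_cast

lemma integral_exp_quarter_sq :
    ∫ g : ℝ, Real.exp (g ^ 2 / 4) ∂(gaussianReal 0 1) = √2 := by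
  have h := integral_cexp_quarter_sq 0
  rw [← Complex.ofReal_inj, ← integral_complex_ofReal]
  simpa using h

lemma integrable_exp_quarter_sq' :
    Integrable (fun g : ℝ => Real.exp (g ^ 2 / 4)) (gaussianReal 0 1) := by
  simpa using integrable_exp_quarter_sq 0

/-- `gaussianTilt` as a mixture of complex exponential tilts. -/
lemma gaussianTilt_eq_integral (a t : ℝ) :
    (gaussianTilt a t : ℂ) =
      ∫ g, Complex.exp (mixPoint a g * t - mixPoint a g ^ 2 / 2) ∂(gaussianReal 0 1) := by
  have h2 : ((√2 : ℝ) : ℂ) ^ 2 = 2 := by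
    rw [← Complex.ofReal_pow, Real.sq_sqrt (by norm_num)]; norm_num
  have h2' : ((√2 : ℝ) : ℂ) ≠ 0 := by simp
  -- The term `-z²/2` contributes `+g²/4`, which only widens the Gaussian weight and leaves it
  -- integrable.
  have h (g : ℝ) : Complex.exp (mixPoint a g * t - mixPoint a g ^ 2 / 2) =
      Complex.exp (a * t - a ^ 2 / 2) *
        Complex.exp (g ^ 2 / 4 + (Complex.I * ((t - a) / √2 : ℝ)) * g) := by
    rw [← Complex.exp_add, mixPoint_sq]
    congr 1
    unfold mixPoint
    push_cast
    field_simp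
    linear_combination (-8 * a * Complex.I * g) * h2
  simp_rw [h]
  rw [integral_const_mul, integral_cexp_quarter_sq, gaussianTilt]
  push_cast
  rw [mul_left_comm, ← Complex.exp_add]
  congr 2
  rw [mul_pow, Complex.I_sq, div_pow, h2]; ring

lemma norm_cexp_mixPoint (a t g : ℝ) :
    ‖Complex.exp (mixPoint a g * t - mixPoint a g ^ 2 / 2)‖ =
      Real.exp (a * t - a ^ 2 / 2) * Real.exp (g ^ 2 / 4) := by
  rw [Complex.norm_exp, ← Real.exp_add, mixPoint_sq]
  congr 1
  simp only [Complex.sub_re, Complex.mul_re, mixPoint_re, Complex.ofReal_re, mixPoint_im,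
    Complex.ofReal_im, mul_zero, sub_zero, Complex.div_ofNat_re, Complex.add_re, Complex.I_re,
    Complex.I_im, zero_mul]
  ring

/-! ### Tilts along directions of `ℝ^d` and their correlations. -/

section
variable {d : ℕ}

/-- Complex exponential moments of the standard Gaussian. -/
lemma integral_cexp_sum_stdGaussian (c : Fin d → ℂ) :
    ∫ x, Complex.exp (∑ i, c i * (x i : ℝ)) ∂(stdGaussian (EuclideanSpace ℝ (Fin d))) =
      Complex.exp ((∑ i, c i ^ 2) / 2) := by
  rw [← map_pi_eq_stdGaussian, integral_map (by fun_prop)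
    (Measurable.aestronglyMeasurable (by fun_prop))]
  simp_rw [Complex.exp_sum]
  rw [integral_fintype_prod_eq_prod (f := fun i (x : ℝ) => Complex.exp (c i * x)), Finset.sum_div,
    Complex.exp_sum]
  refine Finset.prod_congr rfl fun i _ => ?_
  have := complexMGF_id_gaussianReal (μ := 0) (v := 1) (c i)
  simp only [complexMGF, id] at this
  rw [this]; simp

lemma integrable_exp_inner_stdGaussian (w : EuclideanSpace ℝ (Fin d)) :
    Integrable (fun x => Real.exp (inner ℝ x w)) (stdGaussian (EuclideanSpace ℝ (Fin d))) := by
  have h := integral_cexp_sum_stdGaussian (fun i => (w i : ℂ))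
  have hn : Complex.exp ((∑ i, (w i : ℂ) ^ 2) / 2) ≠ 0 := Complex.exp_ne_zero _
  rw [← h] at hn
  convert (MeasureTheory.Integrable.of_integral_ne_zero hn).norm using 2 with x
  rw [Complex.norm_exp]
  congr 1
  rw [PiLp.inner_apply, Complex.re_sum]
  refine Finset.sum_congr rfl fun i _ => ?_
  simp

/-- A complex linear form in the coordinates, with real part direction `p`, imaginary part `q`. -/
lemma integral_cexp_inner_stdGaussian (z z' : ℂ) (u v : EuclideanSpace ℝ (Fin d)) :
    ∫ x, Complex.exp (z * (inner ℝ x u : ℝ) + z' * (inner ℝ x v : ℝ))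
        ∂(stdGaussian (EuclideanSpace ℝ (Fin d))) =
      Complex.exp ((z ^ 2 * (‖u‖ ^ 2 : ℝ) + 2 * z * z' * (inner ℝ u v : ℝ)
        + z' ^ 2 * (‖v‖ ^ 2 : ℝ)) / 2) := by
  have h := integral_cexp_sum_stdGaussian (fun i => z * (u i : ℝ) + z' * (v i : ℝ))
  refine (integral_congr_ae (.of_forall fun x => ?_)).trans (h.trans ?_)
  · simp only
    congr 1
    rw [PiLp.inner_apply, PiLp.inner_apply, Complex.ofReal_sum, Complex.ofReal_sum,
      Finset.mul_sum, Finset.mul_sum, ← Finset.sum_add_distrib]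
    refine Finset.sum_congr rfl fun i _ => ?_
    simp; ring
  · congr 2
    rw [PiLp.inner_apply, EuclideanSpace.real_norm_sq_eq, EuclideanSpace.real_norm_sq_eq,
      Complex.ofReal_sum, Complex.ofReal_sum, Complex.ofReal_sum,
      Finset.mul_sum, Finset.mul_sum, Finset.mul_sum, ← Finset.sum_add_distrib,
      ← Finset.sum_add_distrib]
    refine Finset.sum_congr rfl fun i _ => ?_
    simp; ring

lemma measurable_inner_right (v : EuclideanSpace ℝ (Fin d)) :
    Measurable fun x : EuclideanSpace ℝ (Fin d) => inner ℝ x v := by fun_prop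

/-- Expectation of a tilt along `u` against a complex exponential. -/
lemma integral_gaussianTilt_mul_cexp (a : ℝ) (z : ℂ) {u : EuclideanSpace ℝ (Fin d)} (hu : ‖u‖ = 1)
    (w : EuclideanSpace ℝ (Fin d)) :
    ∫ x, (gaussianTilt a (inner ℝ x u) : ℂ) * Complex.exp (z * (inner ℝ x w : ℝ))
        ∂(stdGaussian (EuclideanSpace ℝ (Fin d))) =
      Complex.exp (z ^ 2 * (‖w‖ ^ 2 : ℝ) / 2) *
        ∫ g, Complex.exp (mixPoint a g * z * (inner ℝ u w : ℝ)) ∂(gaussianReal 0 1) := by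
  simp_rw [gaussianTilt_eq_integral, ← integral_mul_const]
  rw [integral_integral_swap]
  · rw [← integral_const_mul]
    refine integral_congr_ae (.of_forall fun g => ?_)
    simp only
    have h := integral_cexp_inner_stdGaussian (mixPoint a g) z u w
    rw [hu] at h
    have e : Complex.exp (z ^ 2 * (‖w‖ ^ 2 : ℝ) / 2) *
        Complex.exp (mixPoint a g * z * (inner ℝ u w : ℝ)) =
        Complex.exp (- mixPoint a g ^ 2 / 2) * Complex.exp ((mixPoint a g ^ 2 * ((1 : ℝ) ^ 2 : ℝ) +
          2 * mixPoint a g * z * (inner ℝ u w : ℝ) + z ^ 2 * (‖w‖ ^ 2 : ℝ)) / 2) := by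
      rw [← Complex.exp_add, ← Complex.exp_add]
      congr 1; push_cast; ring
    rw [e, ← h, ← integral_const_mul]
    refine integral_congr_ae (.of_forall fun x => ?_)
    simp only
    rw [← Complex.exp_add, ← Complex.exp_add]
    congr 1; ring
  -- For Fubini: the modulus of the tilt splits into a factor in `x` and the factor `exp(g²/4)`.
  · have hi : Integrable (fun p : EuclideanSpace ℝ (Fin d) × ℝ =>
        Real.exp (inner ℝ p.1 (a • u + z.re • w)) * Real.exp (p.2 ^ 2 / 4))
        ((stdGaussian _).prod (gaussianReal 0 1)) :=
      (integrable_exp_inner_stdGaussian _).mul_prod integrable_exp_quarter_sq'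
    refine (hi.const_mul (Real.exp (- a ^ 2 / 2))).mono' ?_ (.of_forall ?_)
    · refine Measurable.aestronglyMeasurable ?_
      unfold Function.uncurry mixPoint
      fun_prop
    · rintro ⟨x, g⟩
      simp only [Function.uncurry, norm_mul, norm_cexp_mixPoint]
      rw [Complex.norm_exp, Complex.re_mul_ofReal, ← Real.exp_add, ← Real.exp_add, ← Real.exp_add,
        ← Real.exp_add, inner_add_right, inner_smul_right, inner_smul_right]
      apply le_of_eq
      congr 1; ring

lemma integrable_gaussianTilt_mul_exp (a : ℝ) (u w : EuclideanSpace ℝ (Fin d)) :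
    Integrable (fun x => gaussianTilt a (inner ℝ x u) * Real.exp (inner ℝ x w))
      (stdGaussian (EuclideanSpace ℝ (Fin d))) := by
  refine ((integrable_exp_inner_stdGaussian ((2 * a) • u + w)).const_mul (√2)).mono' ?_
    (.of_forall fun x => ?_)
  · refine Measurable.aestronglyMeasurable ?_
    exact (measurable_gaussianTilt measurable_const (by fun_prop)).mul (by fun_prop)
  · rw [Real.norm_of_nonneg (mul_nonneg (gaussianTilt_pos _ _).le (Real.exp_pos _).le),
      inner_add_right, inner_smul_right, Real.exp_add, ← mul_assoc]
    gcongr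
    exact gaussianTilt_le _ _

lemma integrable_gaussianTilt (a : ℝ) (u : EuclideanSpace ℝ (Fin d)) :
    Integrable (fun x => gaussianTilt a (inner ℝ x u))
      (stdGaussian (EuclideanSpace ℝ (Fin d))) := by
  simpa using integrable_gaussianTilt_mul_exp a u 0

lemma integral_gaussianTilt (a : ℝ) {u : EuclideanSpace ℝ (Fin d)} (hu : ‖u‖ = 1) :
    ∫ x, gaussianTilt a (inner ℝ x u) ∂(stdGaussian (EuclideanSpace ℝ (Fin d))) = 1 := by
  have h := integral_gaussianTilt_mul_cexp a 0 hu 0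
  simp only [inner_zero_right, Complex.ofReal_zero, mul_zero, Complex.exp_zero, mul_one,
    integral_const, probReal_univ, one_smul] at h
  rw [integral_complex_ofReal] at h
  norm_num at h
  exact_mod_cast h

lemma integrable_gaussianTilt_mul (a b : ℝ) (u v : EuclideanSpace ℝ (Fin d)) :
    Integrable (fun x => gaussianTilt a (inner ℝ x u) * gaussianTilt b (inner ℝ x v))
      (stdGaussian (EuclideanSpace ℝ (Fin d))) := by
  refine ((integrable_gaussianTilt_mul_exp a u ((2 * b) • v)).const_mul (√2)).mono' ?_
    (.of_forall fun x => ?_)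
  · refine Measurable.aestronglyMeasurable ?_
    exact (measurable_gaussianTilt measurable_const (by fun_prop)).mul
      (measurable_gaussianTilt measurable_const (by fun_prop))
  · rw [Real.norm_of_nonneg (mul_nonneg (gaussianTilt_pos _ _).le (gaussianTilt_pos _ _).le),
      inner_smul_right, mul_left_comm]
    gcongr
    · exact (gaussianTilt_pos _ _).le
    · exact gaussianTilt_le _ _

/-- The correlation of two tilts along unit vectors `u`, `v`. -/
lemma integral_gaussianTilt_mul (a b : ℝ) {u v : EuclideanSpace ℝ (Fin d)} (hu : ‖u‖ = 1)
    (hv : ‖v‖ = 1) :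
    ((∫ x, gaussianTilt a (inner ℝ x u) * gaussianTilt b (inner ℝ x v)
        ∂(stdGaussian (EuclideanSpace ℝ (Fin d))) : ℝ) : ℂ) =
      ∫ h, ∫ g, Complex.exp ((inner ℝ u v : ℝ) * (mixPoint a g * mixPoint b h))
        ∂(gaussianReal 0 1) ∂(gaussianReal 0 1) := by
  rw [← integral_complex_ofReal]
  simp_rw [Complex.ofReal_mul, gaussianTilt_eq_integral b, ← integral_const_mul]
  rw [integral_integral_swap]
  · refine integral_congr_ae (.of_forall fun h => ?_)
    simp only
    have e := integral_gaussianTilt_mul_cexp a (mixPoint b h) hu v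
    have e1 (x : EuclideanSpace ℝ (Fin d)) : (gaussianTilt a (inner ℝ x u) : ℂ) *
        Complex.exp (mixPoint b h * (inner ℝ x v : ℝ) - mixPoint b h ^ 2 / 2) =
        Complex.exp (- mixPoint b h ^ 2 / 2) * ((gaussianTilt a (inner ℝ x u) : ℂ) *
          Complex.exp (mixPoint b h * (inner ℝ x v : ℝ))) := by
      rw [mul_left_comm, ← Complex.exp_add]
      congr 2; ring
    simp_rw [e1]
    rw [integral_const_mul, e, hv, ← mul_assoc, ← Complex.exp_add, ← integral_const_mul]
    refine integral_congr_ae (.of_forall fun g => ?_)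
    simp only
    rw [← Complex.exp_add]
    congr 1; push_cast; ring
  · have hi : Integrable (fun p : EuclideanSpace ℝ (Fin d) × ℝ =>
        (gaussianTilt a (inner ℝ p.1 u) * Real.exp (inner ℝ p.1 (b • v))) * Real.exp (p.2 ^ 2 / 4))
        ((stdGaussian _).prod (gaussianReal 0 1)) :=
      (integrable_gaussianTilt_mul_exp a u _).mul_prod integrable_exp_quarter_sq'
    refine (hi.const_mul (Real.exp (- b ^ 2 / 2))).mono' ?_ (.of_forall ?_)
    · refine Measurable.aestronglyMeasurable ?_
      have : Measurable fun p : EuclideanSpace ℝ (Fin d) × ℝ => gaussianTilt a (inner ℝ p.1 u) :=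
        measurable_gaussianTilt measurable_const (by fun_prop)
      unfold Function.uncurry mixPoint
      fun_prop
    · rintro ⟨x, g⟩
      simp only [Function.uncurry, norm_mul, norm_cexp_mixPoint, Complex.norm_real]
      rw [Real.norm_of_nonneg (gaussianTilt_pos _ _).le, inner_smul_right,
        show b * inner ℝ x v - b ^ 2 / 2 = -b ^ 2 / 2 + b * inner ℝ x v by ring, Real.exp_add]
      apply le_of_eq; ring
end

/-! ### Expansion of the correlation to third order in the inner product. -/

/-- The remainder of the exponential series after the cubic term, with a scaling factor. -/
lemma norm_exp_mul_sub_sum_le {r : ℝ} (hr : |r| ≤ 1) (z : ℂ) :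
    ‖Complex.exp (r * z) - ∑ n ∈ Finset.range 4, (r * z) ^ n / (n.factorial : ℂ)‖
      ≤ r ^ 4 * Real.exp ‖z‖ := by
  have h1 : HasSum (fun n : ℕ => (r * z) ^ n / (n.factorial : ℂ)) (Complex.exp (r * z)) := by
    rw [Complex.exp_eq_exp_ℂ]; exact NormedSpace.expSeries_div_hasSum_exp _
  have h2 : HasSum (fun n : ℕ => ‖z‖ ^ n / (n.factorial : ℝ)) (Real.exp ‖z‖) := by
    rw [Real.exp_eq_exp_ℝ]; exact NormedSpace.expSeries_div_hasSum_exp _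
  rw [← hasSum_nat_add_iff' 4] at h1 h2
  -- Each tail term contains `r ^ 4` times a power of `r` of modulus at most one, so the tail is
  -- dominated by that of `exp ‖z‖`.
  have h3 := tsum_of_norm_bounded (f := fun n : ℕ => (r * z) ^ (n + 4) / ((n + 4).factorial : ℂ))
    (h2.mul_left (r ^ 4)) fun n => ?_
  · rw [h1.tsum_eq] at h3
    refine h3.trans ?_
    gcongr
    have : 0 ≤ ∑ i ∈ Finset.range 4, ‖z‖ ^ i / (i.factorial : ℝ) := by positivity
    linarith
  · rw [norm_div, norm_pow, norm_mul, Complex.norm_real, Complex.norm_natCast, mul_pow, pow_add,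
      Real.norm_eq_abs, mul_div_assoc, Even.pow_abs (n := 4) (by decide)]
    have : |r| ^ n ≤ 1 := pow_le_one₀ (abs_nonneg _) hr
    have h5 : 0 ≤ r ^ 4 * (‖z‖ ^ (n + 4) / ((n + 4).factorial : ℝ)) := by positivity
    nlinarith

lemma integrable_pow_gaussianReal (n : ℕ) :
    Integrable (fun g : ℝ => g ^ n) (gaussianReal 0 1) := by
  have h := (memLp_id_gaussianReal (μ := 0) (v := 1) n).integrable_norm_pow'
  rw [← integrable_norm_iff (by fun_prop)]
  simpa using h

lemma integral_pow_one_gaussianReal : ∫ g : ℝ, g ∂(gaussianReal 0 1) = 0 :=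
  integral_id_gaussianReal

lemma integral_pow_two_gaussianReal : ∫ g : ℝ, g ^ 2 ∂(gaussianReal 0 1) = 1 := by
  have h := variance_fun_id_gaussianReal (μ := 0) (v := 1)
  rw [variance_eq_integral (by fun_prop), integral_id_gaussianReal] at h
  simpa using h

lemma integral_pow_three_gaussianReal : ∫ g : ℝ, g ^ 3 ∂(gaussianReal 0 1) = 0 := by
  have h := gaussianReal_map_neg (μ := 0) (v := 1)
  rw [neg_zero] at h
  have h2 : ∫ g : ℝ, g ^ 3 ∂((gaussianReal 0 1).map fun x => -x) =
      ∫ g : ℝ, (-g) ^ 3 ∂(gaussianReal 0 1) :=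
    integral_map (by fun_prop) (by fun_prop)
  rw [h] at h2
  have h3 : ∀ g : ℝ, (-g) ^ 3 = -(g ^ 3) := fun g => by ring
  simp_rw [h3] at h2
  rw [integral_neg] at h2
  linarith

/-- The moments of order at most three of the mixing variable. -/
noncomputable def mixMoment (a : ℝ) : ℕ → ℝ
  | 0 => 1
  | 1 => a
  | 2 => a ^ 2 - 1 / 2
  | 3 => a ^ 3 - 3 / 2 * a
  | _ => 0

lemma integrable_mixPoint_pow (a : ℝ) (n : ℕ) :
    Integrable (fun g => mixPoint a g ^ n) (gaussianReal 0 1) := by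
  unfold mixPoint
  simp_rw [add_pow, mul_pow]
  refine integrable_finsetSum _ fun i _ => ?_
  refine Integrable.mul_const ?_ _
  refine Integrable.const_mul ?_ _
  refine Integrable.const_mul ?_ _
  have h := ((integrable_pow_gaussianReal (n - i)).div_const (√2 ^ (n - i))).ofReal (𝕜 := ℂ)
  refine h.congr (.of_forall fun g => ?_)
  simp [div_pow]

lemma integral_mixPoint_pow (a : ℝ) {n : ℕ} (hn : n < 4) :
    ∫ g, mixPoint a g ^ n ∂(gaussianReal 0 1) = mixMoment a n := by
  have hs : √2 ≠ 0 := by simp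
  have hs2 : √2 ^ 2 = 2 := Real.sq_sqrt (by norm_num)
  have key (A B : ℝ → ℝ) (hA : Integrable A (gaussianReal 0 1)) (hB : Integrable B (gaussianReal 0 1))
      (hAB : ∀ g, mixPoint a g ^ n = (A g : ℂ) + Complex.I * (B g : ℂ)) :
      ∫ g, mixPoint a g ^ n ∂(gaussianReal 0 1) =
        ((∫ g, A g ∂(gaussianReal 0 1) : ℝ) : ℂ) +
          Complex.I * ((∫ g, B g ∂(gaussianReal 0 1) : ℝ) : ℂ) := by
    simp_rw [hAB]
    rw [integral_add hA.ofReal (hB.ofReal.const_mul _), integral_const_mul,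
      integral_complex_ofReal, integral_complex_ofReal]
  have i1 : Integrable (fun g : ℝ => g) (gaussianReal 0 1) := by
    simpa using integrable_pow_gaussianReal 1
  have i2 := integrable_pow_gaussianReal 2
  have i3 := integrable_pow_gaussianReal 3
  interval_cases n
  · simp [mixMoment]
  · rw [key (fun _ => a) (fun g => g / √2) (integrable_const _) (i1.div_const _)
      (fun g => by simp [mixPoint]), integral_div, integral_pow_one_gaussianReal]
    simp [mixMoment]
  · rw [key (fun g => a ^ 2 - g ^ 2 / 2) (fun g => √2 * a * g)
      ((integrable_const _).sub (i2.div_const _)) (i1.const_mul _) (mixPoint_sq a),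
      integral_sub (integrable_const _) (i2.div_const _), integral_div, integral_const_mul,
      integral_pow_one_gaussianReal, integral_pow_two_gaussianReal]
    simp [mixMoment]
  · rw [key (fun g => a ^ 3 - (3 / 2 * a) * g ^ 2)
      (fun g => 3 * a ^ 2 / √2 * g - (1 / (2 * √2)) * g ^ 3)
      ((integrable_const _).sub (i2.const_mul _)) ((i1.const_mul _).sub (i3.const_mul _))
      (fun g => ?_),
      integral_sub (integrable_const _) (i2.const_mul _),
      integral_sub (i1.const_mul _) (i3.const_mul _), integral_const_mul, integral_const_mul,
      integral_const_mul, integral_pow_one_gaussianReal, integral_pow_two_gaussianReal,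
      integral_pow_three_gaussianReal]
    · simp [mixMoment]
    · have h2 : ((√2 : ℝ) : ℂ) ^ 2 = 2 := by
        rw [← Complex.ofReal_pow, hs2]; norm_num
      have h2' : ((√2 : ℝ) : ℂ) ≠ 0 := by simp
      have hI : Complex.I ^ 3 = - Complex.I := by rw [pow_succ, Complex.I_sq]; ring
      have hx : Complex.I * ((g / √2 : ℝ) : ℂ) = Complex.I * g * √2 / 2 := by
        push_cast
        rw [← h2]; field_simp
      have e1 : ((3 * a ^ 2 / √2 * g - (1 / (2 * √2)) * g ^ 3 : ℝ) : ℂ) =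
          (3 * a ^ 2 * g - g ^ 3 / 2) * √2 / 2 := by
        push_cast
        rw [← h2]; field_simp
      rw [e1, mixPoint, hx]
      push_cast
      linear_combination (3 * a * g ^ 2 * Complex.I ^ 2 / 4 + Complex.I ^ 3 * g ^ 3 * √2 / 8) * h2
        + (g ^ 3 * √2 / 4) * hI + (3 * a * g ^ 2 / 2) * Complex.I_sq

/-- AM-GM decouples the two mixing variables; the resulting `exp(g²/4)` is still integrable against
`N(0, 1)`. -/
lemma norm_mixPoint_mul_le (a b g h : ℝ) :
    ‖mixPoint a g * mixPoint b h‖ ≤ (a ^ 2 / 2 + g ^ 2 / 4) + (b ^ 2 / 2 + h ^ 2 / 4) := by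
  rw [norm_mul]
  have h1 := normSq_mixPoint a g
  have h2 := normSq_mixPoint b h
  nlinarith [sq_nonneg (‖mixPoint a g‖ - ‖mixPoint b h‖)]

/-- Taylor expansion under the integral. The factor 2 is the square of `∫ exp(g²/4) = √2`. -/
lemma norm_integral_cexp_sub_moments_le {r : ℝ} (hr : |r| ≤ 1) (a b : ℝ) :
    ‖(∫ h, ∫ g, Complex.exp (r * (mixPoint a g * mixPoint b h)) ∂(gaussianReal 0 1)
        ∂(gaussianReal 0 1)) -
      ∑ n ∈ Finset.range 4, (r : ℂ) ^ n / (n.factorial : ℂ) * (mixMoment a n * mixMoment b n)‖ ≤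
      2 * r ^ 4 * (Real.exp (a ^ 2 / 2) * Real.exp (b ^ 2 / 2)) := by
  set γ := gaussianReal 0 1
  have hdom : Integrable (fun p : ℝ × ℝ => Real.exp (a ^ 2 / 2) * Real.exp (b ^ 2 / 2) *
      (Real.exp (p.1 ^ 2 / 4) * Real.exp (p.2 ^ 2 / 4))) (γ.prod γ) :=
    (integrable_exp_quarter_sq'.mul_prod integrable_exp_quarter_sq').const_mul _
  have hle (p : ℝ × ℝ) : Real.exp ‖mixPoint a p.2 * mixPoint b p.1‖ ≤
      Real.exp (a ^ 2 / 2) * Real.exp (b ^ 2 / 2) *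
      (Real.exp (p.1 ^ 2 / 4) * Real.exp (p.2 ^ 2 / 4)) := by
    rw [← Real.exp_add, ← Real.exp_add, ← Real.exp_add]
    apply Real.exp_le_exp.2
    have := norm_mixPoint_mul_le a b p.2 p.1
    linarith
  have hmeas : Measurable fun p : ℝ × ℝ => mixPoint a p.2 * mixPoint b p.1 := by
    unfold mixPoint; fun_prop
  have hint : Integrable (fun p : ℝ × ℝ => Complex.exp (r * (mixPoint a p.2 * mixPoint b p.1)))
      (γ.prod γ) := by
    refine hdom.mono' (Measurable.aestronglyMeasurable (by fun_prop)) (.of_forall fun p => ?_)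
    refine le_trans ?_ (hle p)
    rw [Complex.norm_exp]
    apply Real.exp_le_exp.2
    refine (Complex.re_le_norm _).trans ?_
    rw [norm_mul, Complex.norm_real, Real.norm_eq_abs]
    exact mul_le_of_le_one_left (norm_nonneg _) hr
  have hpoly (n : ℕ) : Integrable (fun p : ℝ × ℝ =>
      (r * (mixPoint a p.2 * mixPoint b p.1)) ^ n / (n.factorial : ℂ)) (γ.prod γ) := by
    have := ((integrable_mixPoint_pow b n).mul_prod (integrable_mixPoint_pow a n)).const_mul
      ((r : ℂ) ^ n / (n.factorial : ℂ))
    refine this.congr (.of_forall fun p => ?_)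
    simp only [mul_pow]; ring
  have hval {n : ℕ} (hn : n < 4) : ∫ p : ℝ × ℝ,
      (r * (mixPoint a p.2 * mixPoint b p.1)) ^ n / (n.factorial : ℂ) ∂(γ.prod γ) =
      (r : ℂ) ^ n / (n.factorial : ℂ) * (mixMoment a n * mixMoment b n) := by
    have := integral_prod_mul (μ := γ) (ν := γ) (fun h => mixPoint b h ^ n) (fun g => mixPoint a g ^ n)
    rw [integral_mixPoint_pow b hn, integral_mixPoint_pow a hn] at this
    rw [mul_comm (mixMoment a n : ℂ), ← this, ← integral_const_mul]
    refine integral_congr_ae (.of_forall fun p => ?_)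
    simp only [mul_pow]; ring
  have e1 := integral_prod _ hint
  simp only at e1
  rw [← e1, ← Finset.sum_congr rfl fun n hn => hval (Finset.mem_range.1 hn),
    ← integral_finsetSum _ fun n _ => hpoly n, ← integral_sub hint
      (integrable_finsetSum _ fun n _ => hpoly n)]
  refine (norm_integral_le_of_norm_le (hdom.const_mul (r ^ 4)) (.of_forall fun p => ?_)).trans ?_
  · refine (norm_exp_mul_sub_sum_le hr _).trans ?_
    gcongr
    exact hle p
  · rw [integral_const_mul, integral_const_mul, integral_prod_mul (fun g : ℝ => Real.exp (g ^ 2 / 4))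
      (fun g : ℝ => Real.exp (g ^ 2 / 4)), integral_exp_quarter_sq,
      Real.mul_self_sqrt (by norm_num)]
    apply le_of_eq; ring

/-! ### Correlation of moment-matching mixtures. -/

section
variable {d m : ℕ}

/-- The relative density of a mixture of Gaussians `N(a j, 1/2)` along the direction `v`. -/
noncomputable def mixtureDensity (w a : Fin m → ℝ) (v x : EuclideanSpace ℝ (Fin d)) : ℝ :=
  ∑ j, w j * gaussianTilt (a j) (inner ℝ x v)

lemma mixtureDensity_nonneg {w : Fin m → ℝ} (hw : ∀ j, 0 ≤ w j) (a : Fin m → ℝ)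
    (v x : EuclideanSpace ℝ (Fin d)) : 0 ≤ mixtureDensity w a v x :=
  Finset.sum_nonneg fun j _ => mul_nonneg (hw j) (gaussianTilt_pos _ _).le

lemma integrable_mixtureDensity (w a : Fin m → ℝ) (v : EuclideanSpace ℝ (Fin d)) :
    Integrable (mixtureDensity w a v) (stdGaussian (EuclideanSpace ℝ (Fin d))) :=
  integrable_finsetSum _ fun _ _ => (integrable_gaussianTilt _ _).const_mul _

lemma integral_mixtureDensity (w a : Fin m → ℝ) {v : EuclideanSpace ℝ (Fin d)} (hv : ‖v‖ = 1) :
    ∫ x, mixtureDensity w a v x ∂(stdGaussian (EuclideanSpace ℝ (Fin d))) = ∑ j, w j := by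
  unfold mixtureDensity
  rw [integral_finsetSum _ fun j _ => (integrable_gaussianTilt _ _).const_mul _]
  simp_rw [integral_const_mul, integral_gaussianTilt _ hv, mul_one]

lemma mixtureDensity_mul (w a : Fin m → ℝ) (u v x : EuclideanSpace ℝ (Fin d)) :
    mixtureDensity w a u x * mixtureDensity w a v x = ∑ i, ∑ j, (w i * w j) *
      (gaussianTilt (a i) (inner ℝ x u) * gaussianTilt (a j) (inner ℝ x v)) := by
  unfold mixtureDensity
  rw [Finset.sum_mul_sum]
  refine Finset.sum_congr rfl fun i _ => Finset.sum_congr rfl fun j _ => by ring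

lemma integrable_mixtureDensity_mul (w a : Fin m → ℝ) (u v : EuclideanSpace ℝ (Fin d)) :
    Integrable (fun x => mixtureDensity w a u x * mixtureDensity w a v x)
      (stdGaussian (EuclideanSpace ℝ (Fin d))) := by
  simp_rw [mixtureDensity_mul]
  exact integrable_finsetSum _ fun i _ => integrable_finsetSum _ fun j _ =>
    (integrable_gaussianTilt_mul _ _ _ _).const_mul _

/-- If the mixture matches three moments with the standard Gaussian, the correlation of its copies
along two directions decays with the fourth power of the inner product. -/
lemma abs_integral_mixtureDensity_mul_sub_le {w a : Fin m → ℝ} {M : ℝ} (hw : ∀ j, 0 ≤ w j)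
    (h0 : ∑ j, w j = M) (h1 : ∑ j, w j * a j = 0) (h2 : ∑ j, w j * a j ^ 2 = M / 2)
    (h3 : ∑ j, w j * a j ^ 3 = 0) {u v : EuclideanSpace ℝ (Fin d)} (hu : ‖u‖ = 1) (hv : ‖v‖ = 1) :
    |(∫ x, mixtureDensity w a u x * mixtureDensity w a v x
        ∂(stdGaussian (EuclideanSpace ℝ (Fin d)))) - M ^ 2| ≤
      2 * (inner ℝ u v) ^ 4 * (∑ j, w j * Real.exp (a j ^ 2 / 2)) ^ 2 := by
  have hr : |inner ℝ u v| ≤ 1 := by simpa [hu, hv] using abs_real_inner_le_norm u v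
  set r : ℝ := inner ℝ u v
  -- The Gaussian part of `N(a_j, 1/2)` has been traded for imaginary noise, so matching `M · N(0,
  -- 1)` means that the moments of `z` of orders one to three vanish.
  have hmom (n : ℕ) (hn : n < 4) : ∑ j, w j * mixMoment (a j) n = if n = 0 then M else 0 := by
    interval_cases n
    · simpa [mixMoment] using h0
    · simpa [mixMoment] using h1
    · simp only [mixMoment, mul_sub, Finset.sum_sub_distrib, ← Finset.sum_mul, h0, h2]
      norm_num; ring
    · have : ∑ j, w j * mixMoment (a j) 3 = ∑ j, w j * a j ^ 3 - 3 / 2 * ∑ j, w j * a j := by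
        rw [Finset.mul_sum, ← Finset.sum_sub_distrib]
        refine Finset.sum_congr rfl fun j _ => ?_
        simp only [mixMoment]; ring
      rw [this, h1, h3]; norm_num
  have hM : M ^ 2 = ∑ i, ∑ j, (w i * w j) *
      ∑ n ∈ Finset.range 4, r ^ n / (n.factorial : ℝ) * (mixMoment (a i) n * mixMoment (a j) n) := by
    have : ∀ n ∈ Finset.range 4, r ^ n / (n.factorial : ℝ) * ((∑ i, w i * mixMoment (a i) n) *
        (∑ i, w i * mixMoment (a i) n)) = if n = 0 then M ^ 2 else 0 := by
      intro n hn
      rw [hmom n (Finset.mem_range.1 hn)]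
      split_ifs with h
      · subst h; simp [sq]
      · simp
    have h4 := Finset.sum_congr rfl this
    rw [Finset.sum_ite_eq' (Finset.range 4) 0 (fun _ => M ^ 2)] at h4
    simp only [Finset.mem_range, Nat.ofNat_pos, if_true] at h4
    rw [← h4]
    simp_rw [Finset.sum_mul_sum, Finset.mul_sum]
    rw [Finset.sum_comm]
    refine Finset.sum_congr rfl fun i _ => ?_
    rw [Finset.sum_comm]
    refine Finset.sum_congr rfl fun j _ => Finset.sum_congr rfl fun n _ => by ring
  rw [hM]
  simp_rw [mixtureDensity_mul]
  rw [integral_finsetSum _ fun i _ => integrable_finsetSum _ fun j _ =>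
    (integrable_gaussianTilt_mul _ _ _ _).const_mul _, ← Finset.sum_sub_distrib]
  rw [sq (∑ j, w j * Real.exp (a j ^ 2 / 2)), Finset.sum_mul_sum, Finset.mul_sum]
  refine (Finset.abs_sum_le_sum_abs _ _).trans (Finset.sum_le_sum fun i _ => ?_)
  rw [integral_finsetSum _ fun j _ => (integrable_gaussianTilt_mul _ _ _ _).const_mul _,
    ← Finset.sum_sub_distrib, Finset.mul_sum]
  refine (Finset.abs_sum_le_sum_abs _ _).trans (Finset.sum_le_sum fun j _ => ?_)
  rw [integral_const_mul, ← mul_sub, abs_mul, abs_of_nonneg (mul_nonneg (hw i) (hw j))]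
  have key := norm_integral_cexp_sub_moments_le hr (a i) (a j)
  rw [← integral_gaussianTilt_mul _ _ hu hv] at key
  have e : ∑ n ∈ Finset.range 4, (r : ℂ) ^ n / (n.factorial : ℂ) *
      (mixMoment (a i) n * mixMoment (a j) n) = ((∑ n ∈ Finset.range 4,
        r ^ n / (n.factorial : ℝ) * (mixMoment (a i) n * mixMoment (a j) n) : ℝ) : ℂ) := by
    push_cast; rfl
  rw [e, ← Complex.ofReal_sub, Complex.norm_real, Real.norm_eq_abs] at key
  refine (mul_le_mul_of_nonneg_left key (mul_nonneg (hw i) (hw j))).trans (le_of_eq ?_)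
  ring
end

/-! ### The regression model as a tilted standard Gaussian. -/

lemma integral_withDensity_ofReal {α F : Type*} [MeasurableSpace α] [NormedAddCommGroup F]
    [NormedSpace ℝ F] {μ : Measure α} {f : α → ℝ} (hf : Measurable f) (h0 : ∀ x, 0 ≤ f x)
    (g : α → F) :
    ∫ x, g x ∂(μ.withDensity fun x => ENNReal.ofReal (f x)) = ∫ x, f x • g x ∂μ := by
  rw [integral_withDensity_eq_integral_toReal_smul hf.ennreal_ofReal
    (.of_forall fun x => ENNReal.ofReal_lt_top)]
  simp_rw [ENNReal.toReal_ofReal (h0 _)]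

section
variable {d : ℕ}

/-- The covariance matrix with eigenvalue `1 - κ` along the unit vector `v`, and `1` across it. -/
noncomputable def shrunkCov (κ : ℝ) (v : EuclideanSpace ℝ (Fin d)) : Matrix (Fin d) (Fin d) ℝ :=
  1 - κ • Matrix.vecMulVec v v

lemma dotProduct_vecMulVec_mulVec (v w : EuclideanSpace ℝ (Fin d)) :
    (w : Fin d → ℝ) ⬝ᵥ (Matrix.vecMulVec v v).mulVec w = (inner ℝ w v) ^ 2 := by
  rw [Matrix.vecMulVec_mulVec, PiLp.inner_apply, sq, dotProduct_smul]
  simp [dotProduct, mul_comm]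

lemma dotProduct_self_eq_norm_sq (w : EuclideanSpace ℝ (Fin d)) :
    (w : Fin d → ℝ) ⬝ᵥ (w : Fin d → ℝ) = ‖w‖ ^ 2 := by
  rw [EuclideanSpace.real_norm_sq_eq]; simp [dotProduct, sq]

lemma posSemidef_vecMulVec_self (v : EuclideanSpace ℝ (Fin d)) :
    (Matrix.vecMulVec (v : Fin d → ℝ) v).PosSemidef := by
  simpa using Matrix.posSemidef_vecMulVec_self_star (v : Fin d → ℝ)

lemma posSemidef_shrunkCov_sub {κ α : ℝ} (h0 : 0 ≤ κ) (h1 : κ ≤ 1 - α)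
    {v : EuclideanSpace ℝ (Fin d)} (hv : ‖v‖ = 1) :
    (shrunkCov κ v - α • (1 : Matrix (Fin d) (Fin d) ℝ)).PosSemidef := by
  have hd : (1 - Matrix.vecMulVec (v : Fin d → ℝ) v).PosSemidef := by
    refine .of_dotProduct_mulVec_nonneg ?_ fun x => ?_
    · exact Matrix.isHermitian_one.sub (posSemidef_vecMulVec_self v).isHermitian
    · have h := dotProduct_vecMulVec_mulVec v (WithLp.toLp 2 x)
      have h' := dotProduct_self_eq_norm_sq (WithLp.toLp 2 x)
      simp only at h h'
      rw [Matrix.sub_mulVec, Matrix.one_mulVec, star_trivial, dotProduct_sub, h, h', sub_nonneg]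
      have := abs_real_inner_le_norm (WithLp.toLp 2 x) v
      rw [hv, mul_one] at this
      exact sq_le_sq' (abs_le.1 this).1 (abs_le.1 this).2
  -- A nonnegative combination of the identity and the projection orthogonal to `v`.
  have e : shrunkCov κ v - α • (1 : Matrix (Fin d) (Fin d) ℝ) =
      κ • (1 - Matrix.vecMulVec (v : Fin d → ℝ) v) + (1 - α - κ) • 1 := by
    unfold shrunkCov
    module
  rw [e]
  exact (hd.smul h0).add (Matrix.PosSemidef.one.smul (by linarith))

lemma posSemidef_one_sub_shrunkCov {κ : ℝ} (h0 : 0 ≤ κ) (v : EuclideanSpace ℝ (Fin d)) :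
    (1 - shrunkCov κ v).PosSemidef := by
  unfold shrunkCov
  rw [sub_sub_cancel]
  exact (posSemidef_vecMulVec_self v).smul h0

lemma dotProduct_shrunkCov_mulVec (κ : ℝ) (v w : EuclideanSpace ℝ (Fin d)) :
    (w : Fin d → ℝ) ⬝ᵥ (shrunkCov κ v).mulVec w = ‖w‖ ^ 2 - κ * (inner ℝ w v) ^ 2 := by
  unfold shrunkCov
  rw [Matrix.sub_mulVec, Matrix.one_mulVec, Matrix.smul_mulVec, dotProduct_sub, dotProduct_smul,
    dotProduct_vecMulVec_mulVec, dotProduct_self_eq_norm_sq, smul_eq_mul]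

lemma integral_cexp_mul_gaussianReal (v : NNReal) (z : ℂ) :
    ∫ x : ℝ, Complex.exp (z * x) ∂(gaussianReal 0 v) = Complex.exp (v * z ^ 2 / 2) := by
  have := complexMGF_id_gaussianReal (μ := 0) (v := v) z
  simpa only [complexMGF, id, Complex.ofReal_zero, mul_zero, zero_add] using this

lemma measurable_tilt_regression (μ : ℝ) (v : EuclideanSpace ℝ (Fin d)) :
    Measurable fun p : EuclideanSpace ℝ (Fin d) × ℝ => gaussianTilt (μ * p.2) (inner ℝ p.1 v) :=
  measurable_gaussianTilt (measurable_snd.const_mul μ)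
    ((measurable_inner_right v).comp measurable_fst)

lemma integrable_tilt_regression (μ : ℝ) {v : EuclideanSpace ℝ (Fin d)} (hv : ‖v‖ = 1) :
    Integrable (fun p : EuclideanSpace ℝ (Fin d) × ℝ => gaussianTilt (μ * p.2) (inner ℝ p.1 v))
      ((stdGaussian (EuclideanSpace ℝ (Fin d))).prod (gaussianReal 0 1)) := by
  have hm : AEStronglyMeasurable (fun p : EuclideanSpace ℝ (Fin d) × ℝ =>
      gaussianTilt (μ * p.2) (inner ℝ p.1 v))
      ((stdGaussian (EuclideanSpace ℝ (Fin d))).prod (gaussianReal 0 1)) :=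
    (measurable_tilt_regression μ v).aestronglyMeasurable
  refine (integrable_prod_iff' hm).2 ⟨.of_forall fun y => ?_, ?_⟩
  · exact integrable_gaussianTilt (μ * y) v
  simp_rw [Real.norm_of_nonneg (gaussianTilt_pos _ _).le, integral_gaussianTilt _ hv]
  exact integrable_const _

/-- The Gaussian regression model seen as a tilt of the standard Gaussian. -/
lemma gaussianRegression_eq_withDensity {μ b κ σ : ℝ} (hκ : 0 ≤ κ) (hκ1 : κ ≤ 1)
    (hκμ : 1 - κ = 1 / 2 + μ ^ 2) (hb : b * (1 - κ) = μ) (hσ : b * μ + σ ^ 2 = 1)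
    {v : EuclideanSpace ℝ (Fin d)} (hv : ‖v‖ = 1) :
    gaussianRegression (b • v) (shrunkCov κ v) σ =
      ((stdGaussian (EuclideanSpace ℝ (Fin d))).prod (gaussianReal 0 1)).withDensity
        fun p => ENNReal.ofReal (gaussianTilt (μ * p.2) (inner ℝ p.1 v)) := by
  have hS : (shrunkCov κ v).PosSemidef := by
    have := posSemidef_shrunkCov_sub (α := 0) hκ (by linarith) hv
    simpa using this
  have hmeas := measurable_tilt_regression μ v
  have hnn : ∀ p : EuclideanSpace ℝ (Fin d) × ℝ, 0 ≤ gaussianTilt (μ * p.2) (inner ℝ p.1 v) :=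
    fun p => (gaussianTilt_pos _ _).le
  have hint := integrable_tilt_regression μ hv
  have : IsFiniteMeasure (((stdGaussian (EuclideanSpace ℝ (Fin d))).prod
      (gaussianReal 0 1)).withDensity
        fun p => ENNReal.ofReal (gaussianTilt (μ * p.2) (inner ℝ p.1 v))) :=
    isFiniteMeasure_withDensity_ofReal hint.2
  have hmap : Measurable fun p : EuclideanSpace ℝ (Fin d) × ℝ =>
    (p.1, inner ℝ p.1 (b • v) + p.2) := by fun_prop
  have : IsFiniteMeasure (gaussianRegression (b • v) (shrunkCov κ v) σ) := by
    unfold gaussianRegression; infer_instance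
  refine Measure.ext_of_charFunDual ?_
  ext L
  obtain ⟨w, hw⟩ : ∃ w : EuclideanSpace ℝ (Fin d), ∀ x, L (x, 0) = inner ℝ x w := by
    refine ⟨(InnerProductSpace.toDual ℝ _).symm (L.comp (.inl ℝ _ ℝ)), fun x => ?_⟩
    rw [real_inner_comm, InnerProductSpace.toDual_symm_apply]; rfl
  obtain ⟨r, hr⟩ : ∃ r : ℝ, ∀ y, L (0, y) = r * y := by
    refine ⟨L (0, 1), fun y => ?_⟩
    have := L.map_smul y (0, 1)
    simp only [Prod.smul_mk, smul_zero, smul_eq_mul, mul_one] at this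
    rw [this, mul_comm]
  have hL (x : EuclideanSpace ℝ (Fin d)) (y : ℝ) : L (x, y) = inner ℝ x w + r * y := by
    rw [← hw, ← hr, ← map_add]; simp
  set p : ℝ := inner ℝ w v with hp
  have hvw : inner ℝ v w = p := real_inner_comm _ _
  rw [charFunDual_apply, charFunDual_apply]
  -- Both laws are centred Gaussian. The bracket is the variance of `⟨X, w⟩ + r y` when `y` has
  -- variance one and `⟨X, v⟩` is `μ y` plus independent noise of variance 1/2.
  trans Complex.exp (-((‖w‖ ^ 2 - p ^ 2 / 2 + (r + μ * p) ^ 2 : ℝ) : ℂ) / 2)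
  · unfold gaussianRegression
    rw [integral_map hmap.aemeasurable (by fun_prop)]
    simp_rw [hL]
    have e (q : EuclideanSpace ℝ (Fin d) × ℝ) :
        Complex.exp (((inner ℝ q.1 w + r * (inner ℝ q.1 (b • v) + q.2) : ℝ) : ℂ) * Complex.I) =
        Complex.exp ((inner ℝ q.1 (w + (r * b) • v) : ℝ) * Complex.I) *
          Complex.exp ((r * Complex.I) * q.2) := by
      rw [← Complex.exp_add, inner_add_right, inner_smul_right, inner_smul_right]
      congr 1; push_cast; ring
    simp_rw [e]
    rw [integral_prod_mul (fun x : EuclideanSpace ℝ (Fin d) =>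
      Complex.exp ((inner ℝ x (w + (r * b) • v) : ℝ) * Complex.I))
      (fun y : ℝ => Complex.exp ((r * Complex.I) * y)), ← charFun_apply,
      charFun_multivariateGaussian hS, integral_cexp_mul_gaussianReal, ← Complex.exp_add,
      dotProduct_shrunkCov_mulVec, inner_zero_right, ← real_inner_self_eq_norm_sq]
    have h1 : inner ℝ (w + (r * b) • v) v = p + r * b := by
      rw [inner_add_left, real_inner_smul_left, real_inner_self_eq_norm_sq, hv]; ring
    have h2 : inner ℝ (w + (r * b) • v) (w + (r * b) • v) =
        ‖w‖ ^ 2 + 2 * (r * b) * p + (r * b) ^ 2 := by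
      rw [inner_add_left, inner_add_right, inner_add_right, real_inner_smul_left,
        real_inner_smul_left, inner_smul_right, inner_smul_right, real_inner_self_eq_norm_sq,
        real_inner_self_eq_norm_sq, hv, hvw, ← hp]; ring
    have h3 : (((σ ^ 2).toNNReal : NNReal) : ℂ) = ((σ ^ 2 : ℝ) : ℂ) := by
      exact congrArg Complex.ofReal (Real.coe_toNNReal _ (sq_nonneg σ))
    rw [h1, h2, h3, mul_pow (r : ℂ), Complex.I_sq]
    have h4 : ‖w‖ ^ 2 + 2 * (r * b) * p + (r * b) ^ 2 - κ * (p + r * b) ^ 2 + σ ^ 2 * r ^ 2 =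
        ‖w‖ ^ 2 - p ^ 2 / 2 + (r + μ * p) ^ 2 := by
      linear_combination (p ^ 2) * hκμ + (2 * r * p + r ^ 2 * b) * hb + r ^ 2 * hσ
    rw [← h4]
    congr 1; push_cast; ring
  · rw [integral_withDensity_ofReal hmeas hnn]
    have hint2 : Integrable (fun q : EuclideanSpace ℝ (Fin d) × ℝ =>
        gaussianTilt (μ * q.2) (inner ℝ q.1 v) • Complex.exp (L q * Complex.I))
        ((stdGaussian _).prod (gaussianReal 0 1)) := by
      refine hint.mono' (Measurable.aestronglyMeasurable (hmeas.smul (by fun_prop)))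
        (.of_forall fun q => ?_)
      rw [norm_smul, Complex.norm_exp_ofReal_mul_I, mul_one, Real.norm_of_nonneg (hnn q)]
    rw [integral_prod_symm _ hint2]
    have e (y : ℝ) : ∫ x, gaussianTilt (μ * y) (inner ℝ x v) • Complex.exp (L (x, y) * Complex.I)
        ∂(stdGaussian (EuclideanSpace ℝ (Fin d))) =
        Complex.exp (-(‖w‖ ^ 2 : ℝ) / 2 + (p ^ 2 : ℝ) / 4) *
          Complex.exp (((r + μ * p : ℝ) * Complex.I) * y) := by
      have h1 (x : EuclideanSpace ℝ (Fin d)) :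
          gaussianTilt (μ * y) (inner ℝ x v) • Complex.exp (L (x, y) * Complex.I) =
          ((gaussianTilt (μ * y) (inner ℝ x v) : ℂ) * Complex.exp (Complex.I * (inner ℝ x w : ℝ))) *
            Complex.exp ((r * y : ℝ) * Complex.I) := by
        rw [hL, Complex.real_smul, mul_assoc, ← Complex.exp_add]
        congr 2; push_cast; ring
      simp_rw [h1]
      rw [integral_mul_const, integral_gaussianTilt_mul_cexp _ _ hv, hvw]
      have h2 (g : ℝ) : Complex.exp (mixPoint (μ * y) g * Complex.I * p) =
          Complex.exp ((μ * y * p : ℝ) * Complex.I) * Complex.exp ((-(p / √2) : ℝ) * (g : ℂ)) := by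
        rw [← Complex.exp_add]
        congr 1
        unfold mixPoint
        push_cast
        linear_combination (g / (√2 : ℝ) * p) * Complex.I_sq
      simp_rw [h2]
      rw [integral_const_mul, integral_cexp_mul_gaussianReal, ← Complex.ofReal_pow, neg_sq, div_pow,
        Real.sq_sqrt (by norm_num), ← Complex.exp_add, ← Complex.exp_add, ← Complex.exp_add,
        ← Complex.exp_add, Complex.I_sq]
      congr 1
      push_cast; ring
    simp_rw [e]
    rw [integral_const_mul, integral_cexp_mul_gaussianReal, ← Complex.exp_add, mul_pow,
      Complex.I_sq]
    congr 1
    push_cast; ring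
end

/-! ### The outliers that match three moments. -/

/-- Finitely many Gaussians `N(a j y, 1/2)` with weights `w j y`, whose total matches three moments
with a multiple of `N(0, 1)`, and of which the first is the law of a Gaussian regression sample
given the response `y`. -/
structure MatchingMixture (ε : ℝ) where
  w : Fin 6 → ℝ → ℝ
  a : Fin 6 → ℝ → ℝ
  measurable_w : ∀ j, Measurable (w j)
  measurable_a : ∀ j, Measurable (a j)
  w_zero : ∀ y, w 0 y = 1 - ε
  a_zero : ∀ y, a 0 y = √ε / 10 * y
  w_nonneg : ∀ j y, 0 ≤ w j y
  sum_w : ∀ y, ∑ j, w j y = 1 - ε / 2 + ε / 2 * y ^ 2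
  sum_w_mul_a : ∀ y, ∑ j, w j y * a j y = 0
  sum_w_mul_a_sq : ∀ y, ∑ j, w j y * a j y ^ 2 = (1 - ε / 2 + ε / 2 * y ^ 2) / 2
  sum_w_mul_a_cube : ∀ y, ∑ j, w j y * a j y ^ 3 = 0
  a_sq_le : ∀ j y, a j y ^ 2 ≤ y ^ 2 / 8 + 20 / ε

/-- The inliers have mass `1 - ε` at `x = μ y`. Atoms at `-L x` and `2 L x` cancel their first and
third moments, a symmetric pair at `±√(20/ε)` supplies the missing second moment, and an atom at
zero takes the remaining mass. With outlier mass bounded in `y`, cancelling the mean would force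
atoms of size about `|y| / √ε`, too far for the exponential bounds; the extra mass `ε y² / 2` is
what keeps `a_j²` below `y²/8 + 20/ε`. -/
lemma nonempty_matchingMixture {ε : ℝ} (h0 : 0 < ε) (h1 : ε < 1 / 2) :
    Nonempty (MatchingMixture ε) := by
  -- `s` bounds the relative mass `q = s / (1 + s)` of the cancelling atoms. By AM-GM `s² ≥ 4 ε x²`,
  -- so `x / s` is of order `ε^(-1/2)` uniformly in `y`, while `s` stays within the spare mass.
  set s : ℝ → ℝ := fun y => ε * (25 + 4 * y ^ 2) / 100 with hs
  set L : ℝ → ℝ := fun y => 1 + (s y)⁻¹ with hL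
  set q : ℝ → ℝ := fun y => (L y)⁻¹ with hq
  set x : ℝ → ℝ := fun y => √ε / 10 * y with hx
  set M : ℝ → ℝ := fun y => 1 - ε / 2 + ε / 2 * y ^ 2 with hM
  -- `(1 - ε) V` is the second moment of the inliers and the two cancelling atoms; `t` solves `t ·
  -- 20/ε = M/2 - (1 - ε) V`.
  set V : ℝ → ℝ := fun y => x y ^ 2 * (1 + 2 * L y - q y) with hV
  set t : ℝ → ℝ := fun y => ε / 20 * (M y / 2 - (1 - ε) * V y) with ht
  have hspos (y : ℝ) : 0 < s y := by simp only [hs]; positivity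
  have hL1 (y : ℝ) : 1 ≤ L y := by
    have := inv_pos.2 (hspos y); simp only [hL]; linarith
  have hLq (y : ℝ) : L y * q y = 1 := mul_inv_cancel₀ (by linarith [hL1 y])
  have hq0 (y : ℝ) : 0 < q y := inv_pos.2 (by linarith [hL1 y])
  have hq1 (y : ℝ) : q y ≤ 1 := inv_le_one_of_one_le₀ (hL1 y)
  have hqs (y : ℝ) : q y ≤ s y := by
    rw [← inv_inv (s y)]
    exact inv_anti₀ (inv_pos.2 (hspos y)) (by simp only [hL]; linarith)
  have hq3 (y : ℝ) : q y ^ 3 ≤ q y := by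
    have := pow_le_one₀ (n := 2) (hq0 y).le (hq1 y)
    nlinarith [hq0 y]
  have hx2 (y : ℝ) : x y ^ 2 = ε / 100 * y ^ 2 := by
    simp only [hx]; rw [mul_pow, div_pow, Real.sq_sqrt h0.le]; ring
  have hxs (y : ℝ) : x y ^ 2 * (s y)⁻¹ ≤ 1 / 4 := by
    rw [hx2, ← div_eq_mul_inv, div_le_iff₀ (hspos y)]
    simp only [hs]; nlinarith
  have hxs2 (y : ℝ) : (x y * (s y)⁻¹) ^ 2 ≤ 1 / (4 * ε) := by
    rw [mul_pow, inv_pow, hx2, ← div_eq_mul_inv, div_le_div_iff₀ (by have := hspos y; positivity)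
      (by positivity)]
    have e : 1 * s y ^ 2 - ε / 100 * y ^ 2 * (4 * ε) = ε ^ 2 / 100 ^ 2 * (25 - 4 * y ^ 2) ^ 2 := by
      simp only [hs]; ring
    have : 0 ≤ ε ^ 2 / 100 ^ 2 * (25 - 4 * y ^ 2) ^ 2 := by positivity
    linarith
  have hVle (y : ℝ) : V y ≤ 3 * x y ^ 2 + 1 / 2 := by
    have h := hxs y
    have h2 : V y = 3 * x y ^ 2 + 2 * (x y ^ 2 * (s y)⁻¹) - x y ^ 2 * q y := by
      simp only [hV, hL]; ring
    have := mul_nonneg (sq_nonneg (x y)) (hq0 y).le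
    linarith
  have hV0 (y : ℝ) : 0 ≤ V y := by
    simp only [hV]
    exact mul_nonneg (sq_nonneg _) (by linarith [hL1 y, hq1 y])
  have ht0 (y : ℝ) : 0 ≤ t y := by
    simp only [ht]
    refine mul_nonneg (by positivity) ?_
    have h := hVle y
    rw [hx2] at h
    have h3 : (1 - ε) * V y ≤ (1 - ε) * (3 * (ε / 100 * y ^ 2) + 1 / 2) :=
      mul_le_mul_of_nonneg_left h (by linarith)
    have h4 : 0 ≤ ε * y ^ 2 := by positivity
    simp only [hM]
    nlinarith
  have ht1 (y : ℝ) : t y ≤ ε / 40 * M y := by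
    have : 0 ≤ ε / 20 * ((1 - ε) * V y) :=
      mul_nonneg (by positivity) (mul_nonneg (by linarith) (hV0 y))
    simp only [ht]; linarith
  -- The mass left at zero: the cancelling atoms use at most `3 s / 2` and the pair at most `ε M /
  -- 40`, out of the spare `ε/2 + ε y²/2`.
  have hu0 (y : ℝ) : 0 ≤ M y - (1 - ε) * (1 + q y + (q y - q y ^ 3) / 2) - t y := by
    have h := ht1 y
    have h2 : (1 - ε) * (1 + q y + (q y - q y ^ 3) / 2) ≤ (1 - ε) + 3 / 2 * s y := by
      have := hqs y
      have := pow_pos (hq0 y) 3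
      nlinarith [hq0 y, hq3 y]
    have h4 : 0 ≤ ε * y ^ 2 := by positivity
    simp only [hM, hs] at *
    nlinarith
  have hK : √(20 / ε) ^ 2 = 20 / ε := Real.sq_sqrt (by positivity)
  have mM : Measurable M := by simp only [hM]; fun_prop
  have mx : Measurable x := by simp only [hx]; fun_prop
  have mL : Measurable L := by simp only [hL, hs]; fun_prop
  have mq : Measurable q := mL.inv
  have mt : Measurable t := by simp only [ht, hV]; fun_prop
  refine ⟨⟨![fun _ => 1 - ε, fun y => (1 - ε) * (q y + (q y - q y ^ 3) / 3),
    fun y => (1 - ε) * ((q y - q y ^ 3) / 6), fun y => t y / 2, fun y => t y / 2,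
    fun y => M y - (1 - ε) * (1 + q y + (q y - q y ^ 3) / 2) - t y],
    ![x, fun y => - (L y * x y), fun y => 2 * (L y * x y), fun _ => √(20 / ε),
      fun _ => -√(20 / ε), fun _ => 0],
    ?_, ?_, fun y => rfl, fun y => rfl, ?_, ?_, ?_, ?_, ?_, ?_⟩⟩
  · intro j
    fin_cases j
    · exact measurable_const
    · show Measurable fun y => (1 - ε) * (q y + (q y - q y ^ 3) / 3); fun_prop
    · show Measurable fun y => (1 - ε) * ((q y - q y ^ 3) / 6); fun_prop
    · show Measurable fun y => t y / 2; fun_prop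
    · show Measurable fun y => t y / 2; fun_prop
    · show Measurable fun y => M y - (1 - ε) * (1 + q y + (q y - q y ^ 3) / 2) - t y; fun_prop
  · intro j
    fin_cases j
    · exact mx
    · show Measurable fun y => - (L y * x y); fun_prop
    · show Measurable fun y => 2 * (L y * x y); fun_prop
    · exact measurable_const
    · exact measurable_const
    · exact measurable_const
  · intro j y
    fin_cases j
    · show 0 ≤ 1 - ε; linarith
    · show 0 ≤ (1 - ε) * (q y + (q y - q y ^ 3) / 3)
      exact mul_nonneg (by linarith) (by linarith [hq0 y, hq3 y])
    · show 0 ≤ (1 - ε) * ((q y - q y ^ 3) / 6)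
      exact mul_nonneg (by linarith) (by linarith [hq0 y, hq3 y])
    · show 0 ≤ t y / 2; linarith [ht0 y]
    · show 0 ≤ t y / 2; linarith [ht0 y]
    · exact hu0 y
  · intro y
    rw [Fin.sum_univ_six]
    show (1 - ε) + (1 - ε) * (q y + (q y - q y ^ 3) / 3) + (1 - ε) * ((q y - q y ^ 3) / 6) + t y / 2
      + t y / 2 + (M y - (1 - ε) * (1 + q y + (q y - q y ^ 3) / 2) - t y) = M y
    ring
  · intro y
    rw [Fin.sum_univ_six]
    show (1 - ε) * x y + (1 - ε) * (q y + (q y - q y ^ 3) / 3) * (- (L y * x y)) +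
      (1 - ε) * ((q y - q y ^ 3) / 6) * (2 * (L y * x y)) + t y / 2 * √(20 / ε)
      + t y / 2 * (-√(20 / ε)) + (M y - (1 - ε) * (1 + q y + (q y - q y ^ 3) / 2) - t y) * 0 = 0
    linear_combination (-(1 - ε) * x y) * hLq y
  · intro y
    rw [Fin.sum_univ_six]
    show (1 - ε) * x y ^ 2 + (1 - ε) * (q y + (q y - q y ^ 3) / 3) * (- (L y * x y)) ^ 2 +
      (1 - ε) * ((q y - q y ^ 3) / 6) * (2 * (L y * x y)) ^ 2 + t y / 2 * √(20 / ε) ^ 2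
      + t y / 2 * (-√(20 / ε)) ^ 2 +
      (M y - (1 - ε) * (1 + q y + (q y - q y ^ 3) / 2) - t y) * 0 ^ 2 = M y / 2
    have e : t y * (20 / ε) = M y / 2 - (1 - ε) * V y := by
      simp only [ht]; field_simp
    have e2 : (1 - ε) * V y = (1 - ε) * x y ^ 2 * (1 + 2 * L y - q y) := by
      simp only [hV]; ring
    rw [neg_sq √(20 / ε), hK]
    linear_combination e + e2 + ((1 - ε) * x y ^ 2 * (2 * L y - q y * (1 + L y * q y))) * hLq y
  · intro y
    rw [Fin.sum_univ_six]
    show (1 - ε) * x y ^ 3 + (1 - ε) * (q y + (q y - q y ^ 3) / 3) * (- (L y * x y)) ^ 3 +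
      (1 - ε) * ((q y - q y ^ 3) / 6) * (2 * (L y * x y)) ^ 3 + t y / 2 * √(20 / ε) ^ 3
      + t y / 2 * (-√(20 / ε)) ^ 3 +
      (M y - (1 - ε) * (1 + q y + (q y - q y ^ 3) / 2) - t y) * 0 ^ 3 = 0
    linear_combination (-(1 - ε) * x y ^ 3 * (1 + L y * q y + (L y * q y) ^ 2)) * hLq y
  · intro j y
    have hε : 0 < 1 / ε := by positivity
    have h20 : 20 / ε = 20 * (1 / ε) := by ring
    have hb : (L y * x y) ^ 2 ≤ 2 * x y ^ 2 + 1 / 2 * (1 / ε) := by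
      have h := hxs2 y
      have e : L y * x y = x y + x y * (s y)⁻¹ := by simp only [hL]; ring
      have e2 : 1 / (4 * ε) = 1 / 4 * (1 / ε) := by field_simp
      rw [e]
      nlinarith [sq_nonneg (x y - x y * (s y)⁻¹)]
    have hx' : x y ^ 2 ≤ y ^ 2 / 200 := by
      rw [hx2]; nlinarith [sq_nonneg y]
    have hy := sq_nonneg y
    rw [h20]
    fin_cases j
    · show x y ^ 2 ≤ _; linarith
    · show (- (L y * x y)) ^ 2 ≤ _; rw [neg_sq]; linarith
    · show (2 * (L y * x y)) ^ 2 ≤ _; rw [mul_pow]; linarith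
    · show √(20 * (1 / ε)) ^ 2 ≤ _; rw [← h20, hK, h20]; linarith
    · show (-√(20 * (1 / ε))) ^ 2 ≤ _; rw [neg_sq, ← h20, hK, h20]; linarith
    · show (0 : ℝ) ^ 2 ≤ _; norm_num; positivity

/-! ### The contaminated distributions and their pairwise correlations. -/

/-- The law of `(X, y)` for independent standard Gaussians `X ∈ ℝ^d`, `y ∈ ℝ`. -/
noncomputable abbrev stdSample (d : ℕ) : Measure (RegressionSample d) :=
  (stdGaussian (EuclideanSpace ℝ (Fin d))).prod (gaussianReal 0 1)

/-- Since `y` has variance one, reweighting by `M(y)` preserves total mass. -/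
lemma integral_sq_mass (ε : ℝ) :
    Integrable (fun y : ℝ => 1 - ε / 2 + ε / 2 * y ^ 2) (gaussianReal 0 1) ∧
    ∫ y : ℝ, (1 - ε / 2 + ε / 2 * y ^ 2) ∂(gaussianReal 0 1) = 1 := by
  have h2 := (integrable_pow_gaussianReal 2).const_mul (ε / 2)
  refine ⟨(integrable_const _).add h2, ?_⟩
  rw [integral_add (integrable_const _) h2, integral_const_mul, integral_pow_two_gaussianReal]
  simp

namespace MatchingMixture

variable {ε : ℝ} (P : MatchingMixture ε) {d : ℕ}

/-- The density of the contaminated distribution with hidden direction `v`. -/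
noncomputable def density (v : EuclideanSpace ℝ (Fin d)) (p : RegressionSample d) : ℝ :=
  mixtureDensity (fun j => P.w j p.2) (fun j => P.a j p.2) v p.1

/-- The density of the reference distribution. -/
noncomputable def refDensity (_P : MatchingMixture ε) (p : RegressionSample d) : ℝ :=
  1 - ε / 2 + ε / 2 * p.2 ^ 2

lemma measurable_term (v : EuclideanSpace ℝ (Fin d)) (j : Fin 6) :
    Measurable fun p : RegressionSample d =>
      P.w j p.2 * gaussianTilt (P.a j p.2) (inner ℝ p.1 v) :=
  ((P.measurable_w j).comp measurable_snd).mul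
    (measurable_gaussianTilt ((P.measurable_a j).comp measurable_snd)
      ((measurable_inner_right v).comp measurable_fst))

lemma measurable_density (v : EuclideanSpace ℝ (Fin d)) : Measurable (P.density v) := by
  unfold density mixtureDensity
  exact Finset.measurable_sum _ fun j _ => P.measurable_term v j

lemma measurable_refDensity : Measurable (P.refDensity : RegressionSample d → ℝ) := by
  unfold refDensity; fun_prop

lemma density_nonneg (v : EuclideanSpace ℝ (Fin d)) (p : RegressionSample d) :
    0 ≤ P.density v p := mixtureDensity_nonneg (fun j => P.w_nonneg j p.2) _ _ _

lemma integral_density_fst {v : EuclideanSpace ℝ (Fin d)} (hv : ‖v‖ = 1) (y : ℝ) :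
    ∫ x, P.density v (x, y) ∂(stdGaussian (EuclideanSpace ℝ (Fin d))) =
      1 - ε / 2 + ε / 2 * y ^ 2 := by
  rw [← P.sum_w y]
  exact integral_mixtureDensity (fun j => P.w j y) (fun j => P.a j y) hv

lemma integrable_density {v : EuclideanSpace ℝ (Fin d)} (hv : ‖v‖ = 1) :
    Integrable (P.density v) (stdSample d) := by
  have hm : AEStronglyMeasurable (P.density v) (stdSample d) :=
    (P.measurable_density v).aestronglyMeasurable
  refine (integrable_prod_iff' hm).2 ⟨.of_forall fun y => ?_, ?_⟩
  · exact integrable_mixtureDensity (fun j => P.w j y) (fun j => P.a j y) v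
  · simp_rw [Real.norm_of_nonneg (P.density_nonneg _ _), P.integral_density_fst hv]
    exact (integral_sq_mass ε).1

lemma integral_density {v : EuclideanSpace ℝ (Fin d)} (hv : ‖v‖ = 1) :
    ∫ p, P.density v p ∂(stdSample d) = 1 := by
  rw [integral_prod_symm _ (P.integrable_density hv)]
  simp_rw [P.integral_density_fst hv]
  exact (integral_sq_mass ε).2

/-- The density of the outliers. -/
noncomputable def outlierDensity (v : EuclideanSpace ℝ (Fin d)) (p : RegressionSample d) : ℝ :=
  ε⁻¹ * ∑ j : Fin 5, P.w j.succ p.2 * gaussianTilt (P.a j.succ p.2) (inner ℝ p.1 v)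

lemma density_eq (hε : 0 < ε) (v : EuclideanSpace ℝ (Fin d)) (p : RegressionSample d) :
    P.density v p = (1 - ε) * gaussianTilt (√ε / 10 * p.2) (inner ℝ p.1 v) +
      ε * P.outlierDensity v p := by
  unfold density mixtureDensity outlierDensity
  rw [Fin.sum_univ_succ]
  simp only
  rw [P.w_zero, P.a_zero, mul_inv_cancel_left₀ hε.ne']

lemma measurable_outlierDensity (v : EuclideanSpace ℝ (Fin d)) :
    Measurable (P.outlierDensity v) :=
  (Finset.measurable_sum _ fun _ _ => P.measurable_term v _).const_mul _

lemma outlierDensity_nonneg (hε : 0 < ε) (v : EuclideanSpace ℝ (Fin d))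
    (p : RegressionSample d) : 0 ≤ P.outlierDensity v p :=
  mul_nonneg (inv_pos.2 hε).le
    (Finset.sum_nonneg fun _ _ => mul_nonneg (P.w_nonneg _ _) (gaussianTilt_pos _ _).le)

/-- The law of the outliers. -/
noncomputable def outlier (v : EuclideanSpace ℝ (Fin d)) : Measure (RegressionSample d) :=
  (stdSample d).withDensity fun p => ENNReal.ofReal (P.outlierDensity v p)

/-- The full density has mass one and its inlier part mass `1 - ε`; the remaining `ε` is normalised
by `ε⁻¹`. -/
lemma isProbabilityMeasure_outlier (hε : 0 < ε) {v : EuclideanSpace ℝ (Fin d)} (hv : ‖v‖ = 1) :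
    IsProbabilityMeasure (P.outlier v) := by
  have ht := integrable_tilt_regression (√ε / 10) hv
  have hd := P.integrable_density hv
  have e : P.outlierDensity v = fun p => ε⁻¹ * (P.density v p -
      (1 - ε) * gaussianTilt (√ε / 10 * p.2) (inner ℝ p.1 v)) := by
    ext p
    rw [P.density_eq hε, add_sub_cancel_left, inv_mul_cancel_left₀ hε.ne']
  have ho : Integrable (P.outlierDensity v) (stdSample d) := by
    rw [e]; exact (hd.sub (ht.const_mul _)).const_mul _
  have hti : ∫ p : RegressionSample d, gaussianTilt (√ε / 10 * p.2) (inner ℝ p.1 v)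
      ∂(stdSample d) = 1 := by
    rw [integral_prod_symm _ ht]
    simp_rw [integral_gaussianTilt _ hv]
    simp
  have hi : ∫ p, P.outlierDensity v p ∂(stdSample d) = 1 := by
    rw [e, integral_const_mul, integral_sub hd (ht.const_mul _), integral_const_mul, hti,
      P.integral_density hv]
    field_simp; ring
  refine ⟨?_⟩
  unfold outlier
  rw [withDensity_apply _ .univ, Measure.restrict_univ, ← ofReal_integral_eq_lintegral_ofReal ho
    (.of_forall (P.outlierDensity_nonneg hε v)), hi, ENNReal.ofReal_one]

lemma contaminate_eq_withDensity (hε : 0 < ε) (hε1 : ε < 1) (v : EuclideanSpace ℝ (Fin d)) :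
    contaminate ε ((stdSample d).withDensity
      fun p => ENNReal.ofReal (gaussianTilt (√ε / 10 * p.2) (inner ℝ p.1 v))) (P.outlier v) =
    (stdSample d).withDensity fun p => ENNReal.ofReal (P.density v p) := by
  unfold contaminate outlier
  have m1 := (measurable_tilt_regression (√ε / 10) v).ennreal_ofReal
  have m2 := (P.measurable_outlierDensity v).ennreal_ofReal
  rw [← withDensity_smul _ m1, ← withDensity_smul _ m2, ← withDensity_add_left (m1.const_smul _)]
  congr 1
  ext p
  simp only [Pi.add_apply, Pi.smul_apply, smul_eq_mul]
  rw [← ENNReal.ofReal_mul (by linarith), ← ENNReal.ofReal_mul hε.le, ← ENNReal.ofReal_add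
    (mul_nonneg (by linarith) (gaussianTilt_pos _ _).le)
    (mul_nonneg hε.le (P.outlierDensity_nonneg hε v p)), P.density_eq hε]

lemma mass_le_exp (hε : 0 < ε) (hε1 : ε < 1 / 2) (y : ℝ) :
    1 - ε / 2 + ε / 2 * y ^ 2 ≤ 4 * Real.exp (y ^ 2 / 16) := by
  have := Real.add_one_le_exp (y ^ 2 / 16)
  nlinarith [sq_nonneg y]

/-- Mass and exponents each cost `exp(y²/16)`, so the square grows like `exp(y²/4)`, which is
integrable against `N(0, 1)`. The constant `20/ε` originates in `a_sq_le`. -/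
lemma sum_w_mul_exp_sq_le (hε : 0 < ε) (hε1 : ε < 1 / 2) (y : ℝ) :
    (∑ j, P.w j y * Real.exp (P.a j y ^ 2 / 2)) ^ 2 ≤
      16 * Real.exp (20 / ε) * Real.exp (y ^ 2 / 4) := by
  have h1 : ∑ j, P.w j y * Real.exp (P.a j y ^ 2 / 2) ≤
      4 * Real.exp (y ^ 2 / 16) * Real.exp (y ^ 2 / 16 + 10 / ε) := by
    refine le_trans ?_ (mul_le_mul_of_nonneg_right (mass_le_exp hε hε1 y) (Real.exp_pos _).le)
    rw [← P.sum_w y, Finset.sum_mul]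
    refine Finset.sum_le_sum fun j _ => mul_le_mul_of_nonneg_left ?_ (P.w_nonneg j y)
    apply Real.exp_le_exp.2
    have := P.a_sq_le j y
    have e : 10 / ε = 20 / ε / 2 := by ring
    rw [e]; linarith
  have h0 : 0 ≤ ∑ j, P.w j y * Real.exp (P.a j y ^ 2 / 2) :=
    Finset.sum_nonneg fun j _ => mul_nonneg (P.w_nonneg j y) (Real.exp_pos _).le
  refine (pow_le_pow_left₀ h0 h1 2).trans (le_of_eq ?_)
  rw [mul_assoc, mul_assoc, ← Real.exp_add, ← Real.exp_add, mul_pow, ← Real.exp_nat_mul]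
  norm_num
  ring

lemma mass_sq_le (y : ℝ) :
    (1 - ε / 2 + ε / 2 * y ^ 2) ^ 2 ≤ (∑ j, P.w j y * Real.exp (P.a j y ^ 2 / 2)) ^ 2 := by
  rw [← P.sum_w y]
  refine pow_le_pow_left₀ (Finset.sum_nonneg fun j _ => P.w_nonneg j y) ?_ 2
  refine Finset.sum_le_sum fun j _ => le_mul_of_one_le_right (P.w_nonneg j y) ?_
  exact Real.one_le_exp (by positivity)

lemma abs_integral_density_mul_fst_le (hε : 0 < ε) (hε1 : ε < 1 / 2)
    {u v : EuclideanSpace ℝ (Fin d)} (hu : ‖u‖ = 1) (hv : ‖v‖ = 1) (y : ℝ) :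
    |(∫ x, P.density u (x, y) * P.density v (x, y) ∂(stdGaussian (EuclideanSpace ℝ (Fin d)))) -
      (1 - ε / 2 + ε / 2 * y ^ 2) ^ 2| ≤
      32 * Real.exp (20 / ε) * (inner ℝ u v) ^ 4 * Real.exp (y ^ 2 / 4) := by
  have h := abs_integral_mixtureDensity_mul_sub_le (fun j => P.w_nonneg j y) (P.sum_w y)
    (P.sum_w_mul_a y) (P.sum_w_mul_a_sq y) (P.sum_w_mul_a_cube y) hu hv
  refine h.trans ?_
  refine (mul_le_mul_of_nonneg_left (P.sum_w_mul_exp_sq_le hε hε1 y) (by positivity)).trans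
    (le_of_eq ?_)
  ring

lemma memLp_density (hε : 0 < ε) (hε1 : ε < 1 / 2) {v : EuclideanSpace ℝ (Fin d)}
    (hv : ‖v‖ = 1) : MemLp (P.density v) 2 (stdSample d) := by
  have hmd := P.measurable_density v
  rw [memLp_two_iff_integrable_sq hmd.aestronglyMeasurable]
  have hm : AEStronglyMeasurable (fun p => P.density v p ^ 2) (stdSample d) :=
    (hmd.pow_const 2).aestronglyMeasurable
  refine (integrable_prod_iff' hm).2 ⟨.of_forall fun y => ?_, ?_⟩
  · simp_rw [sq]
    exact integrable_mixtureDensity_mul (fun j => P.w j y) (fun j => P.a j y) v v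
  · simp_rw [Real.norm_of_nonneg (sq_nonneg _)]
    -- 48 = 32 + 16: the correlation bound on the diagonal plus the bound on `M(y)²`.
    refine (integrable_exp_quarter_sq'.const_mul (48 * Real.exp (20 / ε))).mono' ?_
      (.of_forall fun y => ?_)
    · exact (hmd.pow_const 2).stronglyMeasurable.integral_prod_left'.aestronglyMeasurable
    · rw [Real.norm_of_nonneg (integral_nonneg fun x => sq_nonneg _)]
      have h := (abs_le.1 (P.abs_integral_density_mul_fst_le hε hε1 hv hv y)).2
      have h2 := (P.mass_sq_le y).trans (P.sum_w_mul_exp_sq_le hε hε1 y)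
      rw [real_inner_self_eq_norm_sq, hv] at h
      simp_rw [sq (P.density v _)]
      linarith

lemma memLp_refDensity (hε : 0 < ε) (hε1 : ε < 1 / 2) :
    MemLp (P.refDensity : RegressionSample d → ℝ) 2 (stdSample d) := by
  have hm : Measurable (P.refDensity : RegressionSample d → ℝ) := P.measurable_refDensity
  rw [memLp_two_iff_integrable_sq hm.aestronglyMeasurable]
  refine ((integrable_exp_quarter_sq'.const_mul (16 * Real.exp (20 / ε))).comp_snd _).mono'
    (hm.pow_const 2).aestronglyMeasurable (.of_forall fun p => ?_)
  rw [Real.norm_of_nonneg (sq_nonneg _)]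
  exact (P.mass_sq_le p.2).trans (P.sum_w_mul_exp_sq_le hε hε1 p.2)

/-- The deviation of the contaminated distribution from the reference distribution. -/
noncomputable def deviation (v : EuclideanSpace ℝ (Fin d)) (p : RegressionSample d) : ℝ :=
  P.density v p - P.refDensity p

lemma memLp_deviation (hε : 0 < ε) (hε1 : ε < 1 / 2) {v : EuclideanSpace ℝ (Fin d)}
    (hv : ‖v‖ = 1) : MemLp (P.deviation v) 2 (stdSample d) :=
  (P.memLp_density hε hε1 hv).sub (P.memLp_refDensity hε hε1)

/-- On each slice of fixed `y` both densities integrate to `M(y)`, so the correlation of the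
deviations is that of the densities minus `M(y)²`. Integrating over `y` costs `√2 ≤ 2`. -/
lemma abs_integral_deviation_mul_le (hε : 0 < ε) (hε1 : ε < 1 / 2)
    {u v : EuclideanSpace ℝ (Fin d)} (hu : ‖u‖ = 1) (hv : ‖v‖ = 1) :
    |∫ p, P.deviation u p * P.deviation v p ∂(stdSample d)| ≤
      64 * Real.exp (20 / ε) * (inner ℝ u v) ^ 4 := by
  have hint := (P.memLp_deviation hε hε1 hu).integrable_mul (P.memLp_deviation hε hε1 hv)
  have h := integral_prod_symm _ hint
  simp only [Pi.mul_apply] at h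
  rw [h]
  have key (y : ℝ) : ‖∫ x, P.deviation u (x, y) * P.deviation v (x, y)
      ∂(stdGaussian (EuclideanSpace ℝ (Fin d)))‖ ≤
      32 * Real.exp (20 / ε) * (inner ℝ u v) ^ 4 * Real.exp (y ^ 2 / 4) := by
    set M : ℝ := 1 - ε / 2 + ε / 2 * y ^ 2 with hM
    have iuv : Integrable (fun x => P.density u (x, y) * P.density v (x, y))
        (stdGaussian (EuclideanSpace ℝ (Fin d))) :=
      integrable_mixtureDensity_mul (fun j => P.w j y) (fun j => P.a j y) u v
    have iu : Integrable (fun x => P.density u (x, y)) (stdGaussian (EuclideanSpace ℝ (Fin d))) :=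
      integrable_mixtureDensity (fun j => P.w j y) (fun j => P.a j y) u
    have iv : Integrable (fun x => P.density v (x, y)) (stdGaussian (EuclideanSpace ℝ (Fin d))) :=
      integrable_mixtureDensity (fun j => P.w j y) (fun j => P.a j y) v
    have e : ∫ x, P.deviation u (x, y) * P.deviation v (x, y)
        ∂(stdGaussian (EuclideanSpace ℝ (Fin d))) =
        (∫ x, P.density u (x, y) * P.density v (x, y)
          ∂(stdGaussian (EuclideanSpace ℝ (Fin d)))) - M ^ 2 := by
      have e1 (x : EuclideanSpace ℝ (Fin d)) : P.deviation u (x, y) * P.deviation v (x, y) =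
          P.density u (x, y) * P.density v (x, y) -
            (M * P.density u (x, y) + M * P.density v (x, y) - M ^ 2) := by
        have : P.refDensity (x, y) = M := rfl
        unfold deviation
        rw [this]; ring
      simp_rw [e1]
      have i1 := (iu.const_mul M).add (iv.const_mul M)
      have i2 := i1.sub (integrable_const (M ^ 2))
      simp only [Pi.add_def, Pi.sub_def] at i1 i2
      rw [integral_sub iuv i2, integral_sub i1 (integrable_const _),
        integral_add (iu.const_mul M) (iv.const_mul M), integral_const_mul, integral_const_mul,
        P.integral_density_fst hu, P.integral_density_fst hv, ← hM]
      simp; ring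
    rw [e, Real.norm_eq_abs]
    exact P.abs_integral_density_mul_fst_le hε hε1 hu hv y
  rw [← Real.norm_eq_abs]
  refine (norm_integral_le_of_norm_le (integrable_exp_quarter_sq'.const_mul _)
    (.of_forall key)).trans ?_
  rw [integral_const_mul, integral_exp_quarter_sq]
  have h2 : √2 ≤ 2 := Real.sqrt_le_iff.2 ⟨by norm_num, by norm_num⟩
  have : 0 ≤ 32 * Real.exp (20 / ε) * (inner ℝ u v) ^ 4 := by positivity
  nlinarith
end MatchingMixture

/-! ### Few distributions separated per query, and the resulting bound for decision trees. -/

/-- A bounded query can be correlated with only few of many nearly orthogonal functions. -/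
lemma sq_card_mul_le_of_correlated {ι Ω : Type*} [MeasurableSpace Ω] {μ : Measure Ω}
    [IsProbabilityMeasure μ] {h : ι → Ω → ℝ} (T : Finset ι) (hh : ∀ i ∈ T, MemLp (h i) 2 μ)
    {χ γ τ : ℝ} (hγ : 0 ≤ γ) (hdiag : ∀ i ∈ T, |∫ x, h i x * h i x ∂μ| ≤ χ)
    (hoff : ∀ i ∈ T, ∀ j ∈ T, i ≠ j → |∫ x, h i x * h j x ∂μ| ≤ γ)
    {f : Ω → ℝ} (hf : Measurable f) (hf1 : ∀ x, |f x| ≤ 1) (hτ : 0 ≤ τ)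
    (hT : ∀ i ∈ T, τ ≤ |∫ x, h i x * f x ∂μ|) :
    (T.card * τ) ^ 2 ≤ T.card * χ + T.card ^ 2 * γ := by
  classical
  -- The signs align all correlations with `f`, so that they add up in the single function `H`.
  set s : ι → ℝ := fun i => SignType.sign (∫ x, h i x * f x ∂μ) with hs
  have hs1 (i : ι) : |s i| ≤ 1 := by
    simp only [hs]
    rcases lt_trichotomy (∫ x, h i x * f x ∂μ) 0 with h | h | h <;> simp [h]
  set H : Ω → ℝ := fun x => ∑ i ∈ T, s i * h i x with hH
  have hHm : MemLp H 2 μ := memLp_finsetSum _ fun i hi => (hh i hi).const_mul _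
  have hHi : Integrable H μ := hHm.integrable (by norm_num)
  have hi1 {i : ι} (hi : i ∈ T) : Integrable (h i) μ := (hh i hi).integrable (by norm_num)
  have hif {g : Ω → ℝ} (hg : Integrable g μ) : Integrable (fun x => g x * f x) μ :=
    hg.mul_bdd (c := 1) hf.aestronglyMeasurable (.of_forall fun x => by simpa using hf1 x)
  have h1 : T.card * τ ≤ ∫ x, |H x| ∂μ := by
    calc T.card * τ = ∑ i ∈ T, τ := by simp
      _ ≤ ∑ i ∈ T, |∫ x, h i x * f x ∂μ| := Finset.sum_le_sum hT
      _ = ∫ x, H x * f x ∂μ := by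
        simp only [hH, Finset.sum_mul]
        rw [integral_finsetSum _ fun i hi => hif ((hi1 hi).const_mul _)]
        refine Finset.sum_congr rfl fun i hi => ?_
        simp_rw [mul_assoc]
        rw [integral_const_mul, sign_mul_self]
      _ ≤ ∫ x, |H x| ∂μ := by
        refine integral_mono (hif hHi) hHi.abs fun x => ?_
        refine (le_abs_self _).trans ?_
        rw [abs_mul]
        exact mul_le_of_le_one_right (abs_nonneg _) (hf1 x)
  -- Nonnegativity of the variance of `|H|`.
  have h2 : (∫ x, |H x| ∂μ) ^ 2 ≤ ∫ x, H x ^ 2 ∂μ := by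
    have hsq : Integrable (fun x => H x ^ 2) μ := hHm.integrable_sq
    set c := ∫ x, |H x| ∂μ with hc
    have : 0 ≤ ∫ x, (|H x| - c) ^ 2 ∂μ := integral_nonneg fun x => sq_nonneg _
    have e (x : Ω) : (|H x| - c) ^ 2 = H x ^ 2 - (2 * c * |H x| - c ^ 2) := by
      rw [sub_sq, sq_abs]; ring
    simp_rw [e] at this
    have i1 : Integrable (fun x => 2 * c * |H x| - c ^ 2) μ :=
      (hHi.abs.const_mul _).sub (integrable_const _)
    rw [integral_sub hsq i1,
      integral_sub (hHi.abs.const_mul _) (integrable_const _), integral_const_mul, ← hc] at this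
    simp at this
    linarith
  have h3 : ∫ x, H x ^ 2 ∂μ ≤ T.card * χ + T.card ^ 2 * γ := by
    have e (x : Ω) : H x ^ 2 = ∑ i ∈ T, ∑ j ∈ T, (s i * s j) * (h i x * h j x) := by
      simp only [hH, sq, Finset.sum_mul_sum]
      exact Finset.sum_congr rfl fun i _ => Finset.sum_congr rfl fun j _ => by ring
    have hij {i j : ι} (hi : i ∈ T) (hj : j ∈ T) :
        Integrable (fun x => (s i * s j) * (h i x * h j x)) μ :=
      ((hh i hi).integrable_mul (hh j hj)).const_mul _
    simp_rw [e]
    rw [integral_finsetSum _ fun i hi => integrable_finsetSum _ fun j hj => hij hi hj]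
    have hb {i j : ι} (hi : i ∈ T) (hj : j ∈ T) : ∫ x, (s i * s j) * (h i x * h j x) ∂μ ≤
        (if i = j then χ else 0) + γ := by
      have hχ : |∫ x, h i x * h j x ∂μ| ≤ (if i = j then χ else 0) + γ := by
        split_ifs with hh
        · subst hh; linarith [hdiag i hi]
        · linarith [hoff i hi j hj hh]
      refine (le_abs_self _).trans (le_trans ?_ hχ)
      rw [integral_const_mul, abs_mul, abs_mul]
      exact mul_le_of_le_one_left (abs_nonneg _)
        (mul_le_one₀ (hs1 i) (abs_nonneg _) (hs1 j))
    calc _ ≤ ∑ i ∈ T, ∑ j ∈ T, ((if i = j then χ else 0) + γ) := by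
          refine Finset.sum_le_sum fun i hi => ?_
          rw [integral_finsetSum _ fun j hj => hij hi hj]
          exact Finset.sum_le_sum fun j hj => hb hi hj
      _ = T.card * χ + T.card ^ 2 * γ := by
          simp_rw [Finset.sum_add_distrib, Finset.sum_ite_eq]
          rw [Finset.sum_congr rfl fun i hi => if_pos hi]
          simp; ring
  exact (pow_le_pow_left₀ (by positivity) h1 2).trans (h2.trans h3)

namespace SQAlgorithm

/-- If every query of tolerance at least `τ` separates at most `K` of the oracles `O i` from the
reference answers `O₀`, an algorithm must ask a finer query, or many queries, or return the same
output for two of the oracles. -/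
lemma exists_fine_or_long_or_eq {Ω α ι : Type*} [MeasurableSpace Ω] {O₀ : StatQuery Ω → ℝ}
    {O : ι → StatQuery Ω → ℝ} {τ K : ℝ} (hK : 0 ≤ K)
    (hkill : ∀ q : StatQuery Ω, τ ≤ q.tol → ∀ T : Finset ι, (∀ i ∈ T, O i q ≠ O₀ q) →
      (T.card : ℝ) ≤ K) (A : SQAlgorithm Ω α) :
    ∀ I : Finset ι, I.Nonempty →
      (∃ i ∈ I, ∃ q ∈ A.queries (O i), q.tol < τ) ∨
      (∃ i ∈ I, (I.card : ℝ) ≤ (A.queries (O i)).length * K + 1) ∨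
      ∃ i ∈ I, ∃ j ∈ I, i ≠ j ∧ A.result (O i) = A.result (O j) := by
  classical
  induction A with
  | output a =>
    intro I hI
    by_cases h : 1 < I.card
    · obtain ⟨i, hi, j, hj, hij⟩ := Finset.one_lt_card.1 h
      exact .inr (.inr ⟨i, hi, j, hj, hij, rfl⟩)
    -- A leaf may be reached by one survivor without contradiction; this is the `+ 1` in the count.
    · obtain ⟨i, hi⟩ := hI
      refine .inr (.inl ⟨i, hi, ?_⟩)
      have : (I.card : ℝ) ≤ 1 := by exact_mod_cast not_lt.1 h
      simpa [queries] using this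
  | query q next ih =>
    intro I hI
    by_cases hq : q.tol < τ
    · obtain ⟨i, hi⟩ := hI
      exact .inl ⟨i, hi, q, by simp [queries], hq⟩
    have hb := hkill q (not_lt.1 hq) (I.filter fun i => O i q ≠ O₀ q) fun i hi =>
      (Finset.mem_filter.1 hi).2
    have hc : ((I.filter fun i => O i q = O₀ q).card : ℝ) +
        (I.filter fun i => O i q ≠ O₀ q).card = I.card := by
      exact_mod_cast Finset.card_filter_add_card_filter_not (s := I) (fun i => O i q = O₀ q)
    -- If no candidate agrees with the reference, this one query accounts for all of `I`. Otherwise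
    -- the agreeing candidates move together into the subtree of the reference answer.
    rcases (I.filter fun i => O i q = O₀ q).eq_empty_or_nonempty with he | hne
    · obtain ⟨i, hi⟩ := hI
      refine .inr (.inl ⟨i, hi, ?_⟩)
      rw [he] at hc
      simp only [Finset.card_empty, Nat.cast_zero, zero_add] at hc
      have : 0 ≤ ((next (O i q)).queries (O i)).length * K := by positivity
      simp only [queries, List.length_cons, Nat.cast_add, Nat.cast_one]
      linarith
    · rcases ih (O₀ q) _ hne with ⟨i, hi, r, hr, hrt⟩ | ⟨i, hi, hlen⟩ | ⟨i, hi, j, hj, hij, he⟩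
      · obtain ⟨hiI, hiq⟩ := Finset.mem_filter.1 hi
        refine .inl ⟨i, hiI, r, ?_, hrt⟩
        simp only [queries, hiq]
        exact List.mem_cons_of_mem _ hr
      · obtain ⟨hiI, hiq⟩ := Finset.mem_filter.1 hi
        refine .inr (.inl ⟨i, hiI, ?_⟩)
        simp only [queries, hiq, List.length_cons, Nat.cast_add, Nat.cast_one]
        linarith
      · obtain ⟨hiI, hiq⟩ := Finset.mem_filter.1 hi
        obtain ⟨hjI, hjq⟩ := Finset.mem_filter.1 hj
        refine .inr (.inr ⟨i, hiI, j, hjI, hij, ?_⟩)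
        simp only [result, hiq, hjq]
        exact he

end SQAlgorithm

/-! ### Sparse, nearly orthogonal directions from Reed-Solomon codes. -/

/-- Reed-Solomon codes: words indexed by polynomials of degree less than `t` agree in fewer than
`t` places. -/
lemma exists_code {p m : ℕ} (t : ℕ) [Fact p.Prime] (hmp : m ≤ p) :
    ∃ f : (Fin t → ZMod p) → Fin m → ZMod p, ∀ c c', c ≠ c' →
      (Finset.univ.filter fun i => f c i = f c' i).card < t := by
  classical
  let e := (Polynomial.degreeLTEquiv (ZMod p) t).symm
  refine ⟨fun c i => (e c : Polynomial (ZMod p)).eval ((i : ℕ) : ZMod p), fun c c' hcc => ?_⟩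
  by_contra! hle
  apply hcc
  apply e.injective
  apply Subtype.ext
  -- As `m ≤ p`, the evaluation points are distinct; two polynomials of degree below `t` agreeing at
  -- `t` of them coincide.
  have hinj : Function.Injective fun i : Fin m => ((i : ℕ) : ZMod p) := by
    intro i j hij
    have h := congrArg ZMod.val hij
    simp only at h
    rw [ZMod.val_natCast_of_lt (i.2.trans_le hmp), ZMod.val_natCast_of_lt (j.2.trans_le hmp)] at h
    exact Fin.ext h
  have hdeg (c : Fin t → ZMod p) : (e c : Polynomial (ZMod p)).degree < t :=
    Polynomial.mem_degreeLT.1 (e c).2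
  rw [← Finset.card_image_of_injective _ hinj] at hle
  have hle' : (t : WithBot ℕ) ≤ _ := Nat.cast_le.2 hle
  refine Polynomial.eq_of_degrees_lt_of_eval_finset_eq _ ((hdeg c).trans_le hle')
    ((hdeg c').trans_le hle') fun x hx => ?_
  obtain ⟨i, hi, rfl⟩ := Finset.mem_image.1 hx
  exact (Finset.mem_filter.1 hi).2

/-- Sparse unit vectors with small pairwise inner products. -/
lemma exists_sparse_packing {p m d : ℕ} (t : ℕ) [Fact p.Prime] (hm : 0 < m) (hmp : m ≤ p)
    (hd : m * p ≤ d) :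
    ∃ v : (Fin t → ZMod p) → EuclideanSpace ℝ (Fin d), (∀ c, ‖v c‖ = 1) ∧
      (∀ c, IsKSparse m (v c)) ∧
      ∀ c c', c ≠ c' → ∃ n : ℕ, n < t ∧ (inner ℝ (v c) (v c') : ℝ) = n / m := by
  classical
  obtain ⟨f, hf⟩ := exists_code (p := p) (m := m) t hmp
  have : NeZero p := ⟨(Fact.out : p.Prime).ne_zero⟩
  obtain ⟨φ⟩ : Nonempty (Fin m × ZMod p ↪ Fin d) := by
    apply Function.Embedding.nonempty_of_card_le
    simpa [ZMod.card] using hd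
  -- The normalised indicator of the graph of a codeword: its support has `m` elements, and inner
  -- products are the fractions of agreeing places.
  set v : (Fin t → ZMod p) → EuclideanSpace ℝ (Fin d) := fun c =>
    (√m)⁻¹ • ∑ i, EuclideanSpace.single (φ (i, f c i)) (1 : ℝ) with hv
  have hinner (c c' : Fin t → ZMod p) : (inner ℝ (v c) (v c') : ℝ) =
      ((Finset.univ.filter fun i => f c i = f c' i).card : ℝ) / m := by
    simp only [hv, real_inner_smul_left, inner_smul_right, sum_inner, inner_sum]
    have e (i j : Fin m) : (inner ℝ (EuclideanSpace.single (φ (i, f c i)) (1 : ℝ))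
        (EuclideanSpace.single (φ (j, f c' j)) (1 : ℝ)) : ℝ) =
        if i = j then (if f c i = f c' i then 1 else 0) else 0 := by
      rw [EuclideanSpace.inner_single_left, map_one, one_mul]
      rw [PiLp.single_apply]
      by_cases hij : i = j
      · subst hij; simp [φ.injective.eq_iff]
      · have : φ (i, f c i) ≠ φ (j, f c' j) := fun h => hij (congrArg Prod.fst (φ.injective h))
        simp [hij, this]
    simp_rw [e]
    have hs : √(m : ℝ) * √m = m := Real.mul_self_sqrt (by positivity)
    rw [← Finset.mul_sum, ← mul_assoc, ← mul_inv, hs]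
    simp [div_eq_inv_mul]
  refine ⟨v, fun c => ?_, fun c => ?_, fun c c' hcc => ⟨_, hf c c' hcc, hinner c c'⟩⟩
  · have h := hinner c c
    rw [real_inner_self_eq_norm_sq] at h
    have hm' : (m : ℝ) ≠ 0 := by positivity
    simp only [Finset.filter_true, Finset.card_univ, Fintype.card_fin, div_self hm'] at h
    exact (pow_eq_one_iff_of_nonneg (norm_nonneg _) two_ne_zero).1 h
  · have hsub : {j | v c j ≠ 0} ⊆
        (Finset.univ.image fun i : Fin m => φ (i, f c i) : Finset (Fin d)) := by
      intro j hj
      by_contra hn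
      apply hj
      simp only [Finset.coe_image, Finset.coe_univ, Set.image_univ, Set.mem_range, not_exists] at hn
      simp only [hv, PiLp.smul_apply, WithLp.ofLp_sum, Finset.sum_apply, smul_eq_mul]
      rw [Finset.sum_eq_zero, mul_zero]
      intro i _
      rw [PiLp.single_apply, if_neg fun h => hn i h.symm]
    unfold IsKSparse
    refine (Set.ncard_le_ncard hsub (Finset.finite_toSet _)).trans ?_
    rw [Set.ncard_coe_finset]
    exact Finset.card_image_le.trans (by simp)

/-! ### Adversarial oracles and the reduction from learning to separating. -/

lemma isProbabilityMeasure_gaussianRegression {d : ℕ} (β : EuclideanSpace ℝ (Fin d))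
    (S : Matrix (Fin d) (Fin d) ℝ) (σ : ℝ) :
    IsProbabilityMeasure (gaussianRegression β S σ) := by
  unfold gaussianRegression
  exact Measure.isProbabilityMeasure_map (Measurable.aemeasurable (by fun_prop))

lemma isProbabilityMeasure_contaminate {Ω : Type*} [MeasurableSpace Ω] {ε : ℝ} (h0 : 0 ≤ ε)
    (h1 : ε ≤ 1) (P Q : Measure Ω) [IsProbabilityMeasure P] [IsProbabilityMeasure Q] :
    IsProbabilityMeasure (contaminate ε P Q) := by
  refine ⟨?_⟩
  simp only [contaminate, Measure.coe_add, Measure.coe_smul, Pi.add_apply, Pi.smul_apply,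
    measure_univ, smul_eq_mul, mul_one]
  rw [← ENNReal.ofReal_add (by linarith) h0]
  simp

open Classical in
/-- The oracle that gives the answers `O₀` whenever they are admissible for `μ`. -/
noncomputable def truncatedOracle {Ω : Type*} [MeasurableSpace Ω] (O₀ : StatQuery Ω → ℝ)
    (μ : Measure Ω) (q : StatQuery Ω) : ℝ :=
  if |O₀ q - ∫ x, q.f x ∂μ| ≤ q.tol then O₀ q else ∫ x, q.f x ∂μ

lemma isSTATOracle_truncatedOracle {Ω : Type*} [MeasurableSpace Ω] (O₀ : StatQuery Ω → ℝ)
    (μ : Measure Ω) : IsSTATOracle μ (truncatedOracle O₀ μ) := by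
  intro q
  unfold truncatedOracle
  split_ifs with h
  · exact h
  · simpa using q.tol_pos.le

lemma lt_abs_of_truncatedOracle_ne {Ω : Type*} [MeasurableSpace Ω] {O₀ : StatQuery Ω → ℝ}
    {μ : Measure Ω} {q : StatQuery Ω} (h : truncatedOracle O₀ μ q ≠ O₀ q) :
    q.tol < |O₀ q - ∫ x, q.f x ∂μ| := by
  by_contra! hle
  exact h (if_pos hle)

/-- An SQ algorithm that learns separated parameters must ask a fine query or many queries, when
every query separates few of the distributions from the reference answers. -/
lemma exists_oracle_of_learns {Ω ι E : Type*} [MeasurableSpace Ω] [NormedAddCommGroup E]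
    [Fintype ι] [Nonempty ι] {β : ι → E} {μ : E → Measure Ω} {O₀ : StatQuery Ω → ℝ} {r τ K N : ℝ}
    (hsep : ∀ i j, i ≠ j → 2 * r < ‖β i - β j‖) (hK : 0 ≤ K)
    (hkill : ∀ q : StatQuery Ω, τ ≤ q.tol → ∀ T : Finset ι,
      (∀ i ∈ T, q.tol < |O₀ q - ∫ x, q.f x ∂(μ (β i))|) → (T.card : ℝ) ≤ K)
    (hN : ∀ n : ℕ, (Fintype.card ι : ℝ) ≤ n * K + 1 → N ≤ n) (A : SQAlgorithm Ω E)
    (hA : ∀ b ∈ Set.range β, ∀ O, IsSTATOracle (μ b) O → ‖b - A.result O‖ ≤ r) :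
    ∃ b ∈ Set.range β, ∃ O, IsSTATOracle (μ b) O ∧
      (N ≤ (A.queries O).length ∨ ∃ q ∈ A.queries O, q.tol < τ) := by
  rcases A.exists_fine_or_long_or_eq (O₀ := O₀) (O := fun i => truncatedOracle O₀ (μ (β i)))
    (τ := τ) hK (fun q hq T hT => hkill q hq T fun i hi => lt_abs_of_truncatedOracle_ne (hT i hi))
    Finset.univ Finset.univ_nonempty with ⟨i, _, q, hq, hqt⟩ | ⟨i, _, h⟩ | ⟨i, _, j, _, hij, h⟩
  · exact ⟨_, ⟨i, rfl⟩, _, isSTATOracle_truncatedOracle _ _, .inr ⟨q, hq, hqt⟩⟩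
  · exact ⟨_, ⟨i, rfl⟩, _, isSTATOracle_truncatedOracle _ _, .inl (hN _ h)⟩
  · exfalso
    have h1 := hA _ ⟨i, rfl⟩ _ (isSTATOracle_truncatedOracle O₀ _)
    have h2 := hA _ ⟨j, rfl⟩ _ (isSTATOracle_truncatedOracle O₀ _)
    rw [← h] at h2
    -- A common output within `r` of both parameters would violate their separation by more than `2
    -- r`.
    have h3 := norm_sub_le_norm_sub_add_norm_sub (β i)
      (A.result (truncatedOracle O₀ (μ (β i)))) (β j)
    rw [norm_sub_rev (A.result _) (β j)] at h3
    linarith [hsep i j hij]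

section
variable {d : ℕ}

/-- The coarse-tolerance case: queries of tolerance at least one carry no information. -/
lemma coarse_case {k : ℕ} {ε τ N : ℝ} (hk : 1 ≤ k) (hkd : (k : ℝ) ≤ √d) (h0 : 0 < ε)
    (h1 : ε < 1 / 2) (hτ : 1 ≤ τ) :
    ∃ (B : Set (EuclideanSpace ℝ (Fin d))) (σ : ℝ)
      (S : EuclideanSpace ℝ (Fin d) → Matrix (Fin d) (Fin d) ℝ)
      (Q : EuclideanSpace ℝ (Fin d) → Measure (RegressionSample d)),
      (99 / 100 : ℝ) ≤ σ ∧ σ ≤ 1 ∧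
      (∀ β ∈ B, IsKSparse k β ∧
        (S β - (1 / 2 : ℝ) • (1 : Matrix (Fin d) (Fin d) ℝ)).PosSemidef ∧
        ((1 : Matrix (Fin d) (Fin d) ℝ) - S β).PosSemidef ∧
        IsProbabilityMeasure (Q β)) ∧
      ∀ A : SQAlgorithm (RegressionSample d) (EuclideanSpace ℝ (Fin d)),
        (∀ β ∈ B, ∀ O : StatQuery (RegressionSample d) → ℝ,
          IsSTATOracle (contaminate ε (gaussianRegression β (S β) σ) (Q β)) O →
            ‖β - A.result O‖ ≤ (10 : ℝ)⁻¹ ^ 5 * √ε) →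
        ∃ β ∈ B, ∃ O : StatQuery (RegressionSample d) → ℝ,
          IsSTATOracle (contaminate ε (gaussianRegression β (S β) σ) (Q β)) O ∧
          (N ≤ ((A.queries O).length : ℝ) ∨ ∃ q ∈ A.queries O, q.tol < τ) := by
  have hd : 0 < d := by
    rcases Nat.eq_zero_or_pos d with h | h
    · subst h
      have : (1 : ℝ) ≤ k := by exact_mod_cast hk
      simp at hkd
      omega
    · exact h
  set e : EuclideanSpace ℝ (Fin d) := EuclideanSpace.single ⟨0, hd⟩ 1
  have he : ‖e‖ = 1 := by simp [e]
  -- Two separated parameters suffice, since the answer 0 is always admissible at tolerance at least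
  -- one. No query then eliminates a candidate, so `K = 0` and the count `2 ≤ n * 0 + 1` fails
  -- whatever `N` is.
  set β : Bool → EuclideanSpace ℝ (Fin d) := fun i => if i then e else 0 with hβ
  refine ⟨Set.range β, 1, fun _ => 1, fun _ => Measure.dirac 0, by norm_num, le_rfl, ?_, ?_⟩
  · rintro _ ⟨i, rfl⟩
    refine ⟨?_, ?_, by simpa using Matrix.PosSemidef.zero, inferInstance⟩
    · unfold IsKSparse
      refine le_trans ?_ hk
      have : {j | β i j ≠ 0} ⊆ {⟨0, hd⟩} := by
        intro j hj
        by_contra hn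
        apply hj
        cases i
        · simp [hβ]
        · simp only [hβ, e, if_true]
          rw [PiLp.single_apply, if_neg (Set.mem_singleton_iff.not.1 hn)]
      refine (Set.ncard_le_ncard this (Set.finite_singleton _)).trans ?_
      simp
    · have e1 : (1 : Matrix (Fin d) (Fin d) ℝ) - (1 / 2 : ℝ) • 1 = (1 / 2 : ℝ) • 1 := by
        module
      rw [e1]
      exact Matrix.PosSemidef.one.smul (by norm_num)
  · intro A hA
    refine exists_oracle_of_learns (β := β) (O₀ := fun _ => 0) (K := 0)
      (μ := fun b => contaminate ε (gaussianRegression b 1 1) (Measure.dirac 0))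
      ?_ le_rfl ?_ ?_ A hA
    · have hs : √ε ≤ 1 := Real.sqrt_le_one.2 (by linarith)
      have hb : 2 * ((10 : ℝ)⁻¹ ^ 5 * √ε) < 1 := by norm_num; linarith
      intro i j hij
      cases i <;> cases j <;> simp_all
    · intro q hq T hT
      have : T = ∅ := by
        rw [Finset.eq_empty_iff_forall_notMem]
        intro i hi
        have h := hT i hi
        have := isProbabilityMeasure_gaussianRegression (β i) 1 1
        have := isProbabilityMeasure_contaminate h0.le (by linarith : ε ≤ 1)
          (gaussianRegression (β i) 1 1) (Measure.dirac 0)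
        have hb := norm_integral_le_of_norm_le_const (μ := contaminate ε
          (gaussianRegression (β i) 1 1) (Measure.dirac 0)) (f := q.f) (C := 1)
          (.of_forall q.abs_f_le_one)
        rw [zero_sub, abs_neg] at h
        rw [Real.norm_eq_abs, probReal_univ] at hb
        linarith
      simp [this]
    · intro n hn
      norm_num at hn

/-- A query of tolerance `τ` separates few hidden directions from the reference distribution. -/
lemma MatchingMixture.card_separated_le {ε : ℝ} (P : MatchingMixture ε) (h0 : 0 < ε)
    (h1 : ε < 1 / 2) {ι : Type*} {v : ι → EuclideanSpace ℝ (Fin d)} (hv : ∀ i, ‖v i‖ = 1) {ρ : ℝ}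
    (hρ : ∀ i j, i ≠ j → |inner ℝ (v i) (v j)| ≤ ρ) (q : StatQuery (RegressionSample d))
    (T : Finset ι)
    (hT : ∀ i ∈ T, q.tol < |(∫ p, P.refDensity p * q.f p ∂(stdSample d)) -
      ∫ p, q.f p ∂((stdSample d).withDensity fun p => ENNReal.ofReal (P.density (v i) p))|) :
    (T.card * q.tol) ^ 2 ≤ T.card * (64 * Real.exp (20 / ε)) +
      T.card ^ 2 * (64 * Real.exp (20 / ε) * ρ ^ 4) := by
  have hbdd {g : RegressionSample d → ℝ} (hg : Integrable g (stdSample d)) :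
      Integrable (fun p => g p * q.f p) (stdSample d) :=
    hg.mul_bdd (c := 1) q.measurable_f.aestronglyMeasurable
      (.of_forall fun p => by simpa using q.abs_f_le_one p)
  refine sq_card_mul_le_of_correlated (μ := stdSample d) (h := fun i => P.deviation (v i)) T
    (fun i _ => P.memLp_deviation h0 h1 (hv i)) (by positivity) (fun i _ => ?_)
    (fun i _ j _ hij => ?_) q.measurable_f q.abs_f_le_one q.tol_pos.le fun i hi => ?_
  · refine (P.abs_integral_deviation_mul_le h0 h1 (hv i) (hv i)).trans ?_
    rw [real_inner_self_eq_norm_sq, hv i]; norm_num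
  · refine (P.abs_integral_deviation_mul_le h0 h1 (hv i) (hv j)).trans ?_
    refine mul_le_mul_of_nonneg_left ?_ (by positivity)
    rw [← Even.pow_abs (n := 4) (by decide)]
    exact pow_le_pow_left₀ (abs_nonneg _) (hρ i j hij) 4
  · refine (hT i hi).le.trans (le_of_eq ?_)
    rw [integral_withDensity_ofReal (P.measurable_density _) (P.density_nonneg _), abs_sub_comm]
    simp_rw [smul_eq_mul]
    rw [← integral_sub (hbdd (P.integrable_density (hv i)))
      (hbdd ((P.memLp_refDensity h0 h1).integrable (by norm_num)))]
    congr 2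
    ext p
    unfold deviation
    ring
end

/-! ### Choice of parameters and the final count. -/

/-- Arithmetic of the packing: a field size `p` and a support size `m` with `m ≤ p`, `m p ≤ d`. -/
lemma exists_prime_packing_size {k d : ℕ} (hk : 16 ≤ k) (hkd : k * k ≤ d) :
    ∃ p m : ℕ, p.Prime ∧ m ≤ k ∧ k ≤ 3 * m ∧ m ≤ p ∧ m * p ≤ d ∧ d ≤ p ^ 8 := by
  set n := d / (2 * k) with hn
  have hmn : k / 2 ≤ n := by
    rw [hn, Nat.le_div_iff_mul_le (by omega)]
    have h2 : k / 2 * 2 ≤ k := Nat.div_mul_le_self k 2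
    calc k / 2 * (2 * k) = k / 2 * 2 * k := by ring
      _ ≤ k * k := Nat.mul_le_mul_right _ h2
      _ ≤ d := hkd
  -- Bertrand's postulate. The upper bound on `p` leaves room for `m p ≤ d`; the lower bound gives
  -- `d ≤ 2 k p`, hence `d ≤ 4 p²` by `k² ≤ d`, and `d ≥ 256` absorbs the constant in `d ≤ p ^ 8`.
  obtain ⟨p, hp, hnp, hpn⟩ := Nat.exists_prime_lt_and_le_two_mul n (by omega)
  refine ⟨p, k / 2, hp, by omega, by omega, by omega, ?_, ?_⟩
  · have h1 : n * (2 * k) ≤ d := Nat.div_mul_le_self _ _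
    have h2 : k / 2 * 2 ≤ k := Nat.div_mul_le_self k 2
    nlinarith
  · have h1 : d < 2 * k * (n + 1) := Nat.lt_mul_div_succ d (by omega)
    have h2 : d ≤ 2 * k * p := h1.le.trans (Nat.mul_le_mul_left _ hnp)
    have h3 : d * d ≤ d * (4 * p ^ 2) := by
      calc d * d ≤ (2 * k * p) * (2 * k * p) := Nat.mul_le_mul h2 h2
        _ = (k * k) * (4 * p ^ 2) := by ring
        _ ≤ d * (4 * p ^ 2) := Nat.mul_le_mul_right _ hkd
    have hd : 256 ≤ d := by nlinarith
    have h4 : d ≤ 4 * p ^ 2 := Nat.le_of_mul_le_mul_left h3 (by omega)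
    have h5 : d ^ 4 ≤ 256 * p ^ 8 := by
      calc d ^ 4 ≤ (4 * p ^ 2) ^ 4 := Nat.pow_le_pow_left h4 4
        _ = 256 * p ^ 8 := by ring
    have h6 : 256 * d ≤ 256 * p ^ 8 := by
      calc 256 * d ≤ d ^ 3 * d := Nat.mul_le_mul_right _ (by nlinarith [Nat.pow_le_pow_left hd 2])
        _ = d ^ 4 := by ring
        _ ≤ _ := h5
    omega

/-- Agreements number at most `k ^ c` out of `m ≥ k / 3` places. -/
lemma inner_scale_bound {k m n : ℕ} {c : ℝ} (hk : 0 < k) (hkm : k ≤ 3 * m)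
    (hn : n < ⌊(k : ℝ) ^ c⌋₊ + 1) : (n : ℝ) / m ≤ 3 * (k : ℝ) ^ (c - 1) := by
  have hk' : (0 : ℝ) < k := by exact_mod_cast hk
  have hm' : (0 : ℝ) < m := by exact_mod_cast (by omega : 0 < m)
  have hkm' : (k : ℝ) ≤ 3 * m := by exact_mod_cast hkm
  have h1 : (n : ℝ) ≤ (k : ℝ) ^ c :=
    (Nat.le_floor_iff (by positivity)).1 (Nat.lt_succ_iff.1 hn)
  rw [Real.rpow_sub_one hk'.ne', div_le_iff₀ hm']
  refine h1.trans ?_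
  have : 0 ≤ (k : ℝ) ^ c := by positivity
  rw [← mul_div_assoc, div_mul_eq_mul_div, le_div_iff₀ hk']
  nlinarith

/-- The code size in terms of `d`: the 8 in `d ≤ p ^ 8` cancels the 8 in the exponent, and `c k ^ c`
is below the code dimension. -/
lemma rpow_le_prime_pow {k d p : ℕ} {c : ℝ} (hc0 : 0 < c) (hc1 : c < 1) (hp : 0 < p)
    (hd : d ≤ p ^ 8) (hd1 : 1 ≤ d) :
    (d : ℝ) ^ (c * (k : ℝ) ^ c / 8) ≤ (p : ℝ) ^ (⌊(k : ℝ) ^ c⌋₊ + 1) := by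
  have hp1 : (1 : ℝ) ≤ p := by exact_mod_cast hp
  have hd' : (d : ℝ) ≤ (p : ℝ) ^ (8 : ℝ) := by
    have : (d : ℝ) ≤ (p : ℝ) ^ 8 := by exact_mod_cast hd
    simpa using this
  have hkc : 0 ≤ (k : ℝ) ^ c := by positivity
  calc (d : ℝ) ^ (c * (k : ℝ) ^ c / 8) ≤ ((p : ℝ) ^ (8 : ℝ)) ^ (c * (k : ℝ) ^ c / 8) :=
        Real.rpow_le_rpow (by positivity) hd' (by positivity)
    _ = (p : ℝ) ^ (c * (k : ℝ) ^ c) := by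
        rw [← Real.rpow_mul (by positivity)]; congr 1; ring
    _ ≤ (p : ℝ) ^ ((⌊(k : ℝ) ^ c⌋₊ + 1 : ℕ) : ℝ) := by
        refine Real.rpow_le_rpow_of_exponent_le hp1 ?_
        have := (Nat.lt_floor_add_one ((k : ℝ) ^ c)).le
        push_cast
        nlinarith
    _ = _ := Real.rpow_natCast _ _

/-- The size of a separated set, from the second moment bound. -/
lemma card_le_of_sq_le {k : ℕ} {ε c τ T : ℝ} (hk : 0 < k) (h0 : 0 < ε) (h1 : ε < 1 / 2)
    (hτ : (k : ℝ) ^ (-2 + 2 * c) * Real.exp (20 / ε) ≤ τ) (hT0 : 0 ≤ T)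
    (hT : (T * τ) ^ 2 ≤ T * (64 * Real.exp (20 / ε)) +
      T ^ 2 * (64 * Real.exp (20 / ε) * (3 * (k : ℝ) ^ (c - 1)) ^ 4)) :
    T ≤ (k : ℝ) ^ (4 - 4 * c) / 2 := by
  rcases hT0.eq_or_lt with h | hT0
  · rw [← h]; positivity
  have hk' : (0 : ℝ) < k := by exact_mod_cast hk
  set κ : ℝ := (k : ℝ) ^ (-4 + 4 * c) with hκ
  have hκ0 : 0 < κ := by positivity
  set E := Real.exp (20 / ε) with hE
  have hE0 : 0 < E := Real.exp_pos _
  have hE1 : 83 * 64 ≤ E := by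
    have h40 : Real.exp 40 ≤ E := by
      apply Real.exp_le_exp.2
      rw [le_div_iff₀ h0]; linarith
    have h2 : (2 : ℝ) ^ 40 ≤ Real.exp 40 := by
      have := pow_le_pow_left₀ (by norm_num) (Real.add_one_le_exp (1 : ℝ)) 40
      rw [← Real.exp_nat_mul] at this
      norm_num at this ⊢
      exact this
    norm_num at h2
    linarith
  have e1 : ((k : ℝ) ^ (-2 + 2 * c)) ^ 2 = κ := by
    rw [← Real.rpow_natCast, ← Real.rpow_mul hk'.le, hκ]; congr 1; push_cast; ring
  have e2 : ((k : ℝ) ^ (c - 1)) ^ 4 = κ := by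
    rw [← Real.rpow_natCast, ← Real.rpow_mul hk'.le, hκ]; congr 1; push_cast; ring
  have e3 : (k : ℝ) ^ (4 - 4 * c) = κ⁻¹ := by
    rw [hκ, ← Real.rpow_neg hk'.le]; congr 1; ring
  have hτ2 : κ * E ^ 2 ≤ τ ^ 2 := by
    rw [← e1, ← mul_pow]
    exact pow_le_pow_left₀ (by positivity) hτ 2
  rw [mul_pow 3, e2] at hT
  have h3 : T * (T * (κ * E ^ 2)) ≤ T * (64 * E + T * (64 * E * (3 ^ 4 * κ))) := by
    have := mul_le_mul_of_nonneg_left hτ2 (sq_nonneg T)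
    nlinarith
  have h4 := le_of_mul_le_mul_left h3 hT0
  have h5 : E * (T * κ * E) ≤ E * (64 + T * κ * (81 * 64)) := by nlinarith
  have h6 := le_of_mul_le_mul_left h5 hE0
  -- 83 = 81 + 2: the 81 absorbs the off-diagonal term and the 2 leaves `T κ ≤ 1/2`.
  have h7 : T * κ * (83 * 64) ≤ T * κ * E := mul_le_mul_of_nonneg_left hE1 (by positivity)
  rw [e3, inv_eq_one_div, div_div, le_div_iff₀ (by positivity)]
  linarith

theorem mainTheorem4 :
    ∃ C : ℝ, 0 < C ∧
      ∀ (k d : ℕ) (ε c : ℝ), 1 ≤ k → (k : ℝ) ≤ Real.sqrt d →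
        0 < ε → ε < 1 / 2 → 0 < c → c < 1 →
      ∃ (B : Set (EuclideanSpace ℝ (Fin d))) (σ : ℝ)
        (S : EuclideanSpace ℝ (Fin d) → Matrix (Fin d) (Fin d) ℝ)
        (Q : EuclideanSpace ℝ (Fin d) → Measure (RegressionSample d)),
        (99 / 100 : ℝ) ≤ σ ∧ σ ≤ 1 ∧
        (∀ β ∈ B, IsKSparse k β ∧
          (S β - (1 / 2 : ℝ) • (1 : Matrix (Fin d) (Fin d) ℝ)).PosSemidef ∧
          ((1 : Matrix (Fin d) (Fin d) ℝ) - S β).PosSemidef ∧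
          IsProbabilityMeasure (Q β)) ∧
        ∀ A : SQAlgorithm (RegressionSample d) (EuclideanSpace ℝ (Fin d)),
          (∀ β ∈ B, ∀ O : StatQuery (RegressionSample d) → ℝ,
            IsSTATOracle (contaminate ε (gaussianRegression β (S β) σ) (Q β)) O →
              ‖β - A.result O‖ ≤ (10 : ℝ)⁻¹ ^ 5 * Real.sqrt ε) →
          ∃ β ∈ B, ∃ O : StatQuery (RegressionSample d) → ℝ,
            IsSTATOracle (contaminate ε (gaussianRegression β (S β) σ) (Q β)) O ∧
            ((d : ℝ) ^ (c * (k : ℝ) ^ c / 8) * (k : ℝ) ^ (-4 + 4 * c) ≤ ((A.queries O).length : ℝ) ∨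
              ∃ q ∈ A.queries O, q.tol < (k : ℝ) ^ (-2 + 2 * c) * Real.exp (C / ε)) := by
  -- The squared tolerance carries `exp(20/ε)²` against a single `exp(20/ε)` in the correlations, so
  -- the same 20 works.
  refine ⟨20, by norm_num, ?_⟩
  intro k d ε c hk hkd h0 h1 hc0 hc1
  by_cases hτ : 1 ≤ (k : ℝ) ^ (-2 + 2 * c) * Real.exp (20 / ε)
  · exact coarse_case hk hkd h0 h1 hτ
  rw [not_le] at hτ
  have hk1 : (1 : ℝ) ≤ k := by exact_mod_cast hk
  have hk0 : (0 : ℝ) < k := by linarith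
  have hkd2 : k * k ≤ d := by
    have := (Real.le_sqrt (by positivity) (by positivity)).1 hkd
    rw [sq] at this
    exact_mod_cast this
  -- the dimension is large
  have hsmall : (k : ℝ) ^ (c - 1) ≤ 1 / 16 := by
    have e : ((k : ℝ) ^ (c - 1)) ^ 2 = (k : ℝ) ^ (-2 + 2 * c) := by
      rw [← Real.rpow_natCast, ← Real.rpow_mul hk0.le]; congr 1; push_cast; ring
    have hE : (256 : ℝ) ≤ Real.exp (20 / ε) := by
      have h8 : Real.exp 8 ≤ Real.exp (20 / ε) := by
        apply Real.exp_le_exp.2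
        rw [le_div_iff₀ h0]; linarith
      have h2 : (2 : ℝ) ^ 8 ≤ Real.exp 8 := by
        have := pow_le_pow_left₀ (by norm_num) (Real.add_one_le_exp (1 : ℝ)) 8
        rw [← Real.exp_nat_mul] at this
        norm_num at this ⊢
        exact this
      norm_num at h2
      linarith
    rw [← e] at hτ
    have hp : 0 ≤ (k : ℝ) ^ (c - 1) := by positivity
    nlinarith
  have hk16 : 16 ≤ k := by
    have h2 : (k : ℝ) ^ (-1 : ℝ) ≤ (k : ℝ) ^ (c - 1) :=
      Real.rpow_le_rpow_of_exponent_le hk1 (by linarith)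
    rw [Real.rpow_neg_one] at h2
    have h3 : (k : ℝ)⁻¹ ≤ 16⁻¹ := by linarith
    have := (inv_le_inv₀ hk0 (by norm_num)).1 h3
    exact_mod_cast this
  -- the hidden directions
  obtain ⟨p, m, hp, hmk, hkm, hmp, hmpd, hdp⟩ := exists_prime_packing_size hk16 hkd2
  have : Fact p.Prime := ⟨hp⟩
  -- With this `t`, distinct codewords agree in at most `⌊k ^ c⌋` places, while the code dimension
  -- exceeds `k ^ c`.
  set t := ⌊(k : ℝ) ^ c⌋₊ + 1 with ht
  obtain ⟨v, hv, hsparse, hinner⟩ := exists_sparse_packing t (by omega) hmp hmpd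
  have hρ (i j : Fin t → ZMod p) (hij : i ≠ j) :
      |inner ℝ (v i) (v j)| ≤ 3 * (k : ℝ) ^ (c - 1) := by
    obtain ⟨n, hn, he⟩ := hinner i j hij
    rw [he, abs_of_nonneg (by positivity)]
    exact inner_scale_bound (by omega) hkm hn
  have : NeZero p := ⟨hp.ne_zero⟩
  -- the parameters of the regression model
  obtain ⟨P⟩ := nonempty_matchingMixture h0 h1
  set μ : ℝ := √ε / 10 with hμ
  have hμ0 : 0 < μ := by positivity
  have hμ2 : μ ^ 2 = ε / 100 := by rw [hμ, div_pow, Real.sq_sqrt h0.le]; norm_num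
  -- `κ`, `b` and `σ` solve three equations: `⟨X, v⟩` has variance `1/2 + μ²`, its covariance with
  -- `y` is `μ`, and `y` has variance one.
  set κ : ℝ := 1 / 2 - μ ^ 2 with hκ
  set b : ℝ := 2 * μ / (1 + 2 * μ ^ 2) with hb
  have hbpos : 0 < b := by positivity
  have hbμ : μ ≤ b := by
    rw [hb, le_div_iff₀ (by positivity)]; nlinarith
  set σ : ℝ := √(1 / (1 + 2 * μ ^ 2)) with hσ
  have hσ2 : σ ^ 2 = 1 / (1 + 2 * μ ^ 2) := Real.sq_sqrt (by positivity)
  -- The covariance and the outliers are functions of `β`, from which they recover the direction as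
  -- `b⁻¹ • β`.
  have hdir (i : Fin t → ZMod p) : b⁻¹ • b • v i = v i := inv_smul_smul₀ hbpos.ne' _
  have hmodel (i : Fin t → ZMod p) :
      contaminate ε (gaussianRegression (b • v i) (shrunkCov κ (b⁻¹ • b • v i)) σ)
        (P.outlier (b⁻¹ • b • v i)) =
      (stdSample d).withDensity fun p => ENNReal.ofReal (P.density (v i) p) := by
    rw [hdir, gaussianRegression_eq_withDensity (μ := μ) (by linarith) (by linarith)
      (by linarith) ?_ ?_ (hv i), P.contaminate_eq_withDensity h0 (by linarith)]
    · rw [hb, hκ]; field_simp; ring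
    · rw [hσ2, hb]; field_simp; ring
  refine ⟨Set.range fun i => b • v i, σ, fun β => shrunkCov κ (b⁻¹ • β),
    fun β => P.outlier (b⁻¹ • β), ?_, ?_, ?_, ?_⟩
  · refine Real.le_sqrt_of_sq_le ?_
    rw [le_div_iff₀ (by positivity), hμ2]
    linarith
  · refine Real.sqrt_le_one.2 ?_
    rw [div_le_one (by positivity)]
    linarith [sq_nonneg μ]
  · rintro _ ⟨i, rfl⟩
    simp only
    rw [hdir]
    refine ⟨?_, posSemidef_shrunkCov_sub (by linarith) (by linarith [sq_nonneg μ]) (hv i),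
      posSemidef_one_sub_shrunkCov (by linarith) _, P.isProbabilityMeasure_outlier h0 (hv i)⟩
    refine le_trans (Set.ncard_le_ncard ?_ (Set.toFinite _)) ((hsparse i).trans hmk)
    intro j hj hn
    exact hj (by simp [hn])
  · intro A hA
    refine exists_oracle_of_learns (β := fun i => b • v i)
      (μ := fun β => contaminate ε (gaussianRegression β (shrunkCov κ (b⁻¹ • β)) σ)
        (P.outlier (b⁻¹ • β)))
      (O₀ := fun q => ∫ p, P.refDensity p * q.f p ∂(stdSample d))
      (K := (k : ℝ) ^ (4 - 4 * c) / 2) ?_ (by positivity) ?_ ?_ A hA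
    · intro i j hij
      -- Inner products are at most 3/16. With `b ≥ √ε / 10`, the parameters are then far more than
      -- twice the accuracy apart.
      have hij' : (1 : ℝ) ≤ ‖v i - v j‖ := by
        have h2 : ‖v i - v j‖ ^ 2 = 2 - 2 * inner ℝ (v i) (v j) := by
          rw [norm_sub_sq_real, hv, hv]; ring
        have h3 := (abs_le.1 (hρ i j hij)).2
        have h4 : (1 : ℝ) ≤ ‖v i - v j‖ ^ 2 := by linarith
        nlinarith [norm_nonneg (v i - v j)]
      rw [← smul_sub, norm_smul, Real.norm_of_nonneg hbpos.le]
      have h5 : b * 1 ≤ b * ‖v i - v j‖ := mul_le_mul_of_nonneg_left hij' hbpos.le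
      have h6 : 0 < √ε := by positivity
      norm_num
      linarith
    · intro q hq T hT
      simp only [hmodel] at hT
      exact card_le_of_sq_le (by omega) h0 h1 hq (by positivity)
        (P.card_separated_le h0 h1 hv hρ q T hT)
    · intro n hn
      have hcard : Fintype.card (Fin t → ZMod p) = p ^ t := by simp [ZMod.card]
      rw [hcard] at hn
      push_cast at hn
      have h2 := rpow_le_prime_pow (k := k) hc0 hc1 hp.pos hdp (by nlinarith)
      rw [← ht] at h2
      -- This gives `p ^ t - 1 ≥ p ^ t / 2`; the lost factor is compensated by the 1/2 in `K`.
      have h3 : (2 : ℝ) ≤ (p : ℝ) ^ t := by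
        have h4 : (2 : ℝ) ≤ p := by exact_mod_cast hp.two_le
        have h5 : (1 : ℝ) ≤ (p : ℝ) ^ (t - 1) := one_le_pow₀ (by linarith)
        have h6 : (p : ℝ) ^ t = (p : ℝ) ^ (t - 1) * p := by rw [← pow_succ]; rfl
        nlinarith
      have e3 : (k : ℝ) ^ (-4 + 4 * c) = ((k : ℝ) ^ (4 - 4 * c))⁻¹ := by
        rw [← Real.rpow_neg hk0.le]; congr 1; ring
      rw [e3, ← div_eq_mul_inv, div_le_iff₀ (by positivity)]
      linarith
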